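/- Let $d\in\mathbb N$ and $\mathbb T^d=(\mathbb R/2\pi\mathbb Z)^d$ with Lebesgue measure. For $k\in\mathbb Z^d$ put $\varphi_k(x)=(2\pi)^{-d/2}e^{ik\cdot x}$ and $\lambda_k=|k|^2$, and for real-valued $f\in L^2(\mathbb T^d)$ let $\langle f,\varphi_k\rangle=\int_{\mathbb T^d}f\,\overline{\varphi_k}\,dx$. Let $H^1(\mathbb T^d)$ be the space of real-valued $f\in L^2(\mathbb T^d)$ with $\sum_k\lambda_k|\langle f,\varphi_k\rangle|^2<\infty$, with norm $\|f\|_{H^1}^2=\|f\|_{L^2}^2+\sum_k\lambda_k|\langle f,\varphi_k\rangle|^2$, and put $\|(w,v)\|_{H^1\times L^2}^2=\|w\|_{H^1}^2+\|v\|_{L^2}^2$. Consider the bilinear wave equation $$\partial_t^2 w(x,t)=\Big(\Delta+\sum_{j=0}^{2d}p_j(t)\mu_j(x)\Big)w(x,t),\qquad(\mu_0,\dots,\mu_{2d})=(1,\cos x_1,\sin x_1,\dots,\cos x_d,\sin x_d).\tag{1}$$ For a control $p:[0,\tau]\to\mathbb R^{2d+1}$ and $W_0\in H^1\times L^2(\mathbb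 T^d)$, the solution of (1) with initial condition $(w,\partial_tw)(0)=W_0$ is the function $W=(w,\partial_t w)\in C^0([0,\tau],H^1\times L^2(\mathbb T^d))$ such that $$W(t)=e^{t\mathcal A}W_0+\int_0^te^{(t-s)\mathcal A}\Big(\sum_{j=0}^{2d}p_j(s)\mu_j\mathcal B\Big)W(s)\,ds,\qquad t\in[0,\tau],$$ where $\mathcal B(w,v)=(0,w)$ and $e^{t\mathcal A}$ is the free wave evolution: $e^{t\mathcal A}(w_0,v_0)=(w(t),v(t))$ with $$w(t)=\sum_{k}\Big(\langle w_0,\varphi_k\rangle\cos(\sqrt{\lambda_k}t)+\langle v_0,\varphi_k\rangle\tfrac{\sin(\sqrt{\lambda_k}t)}{\sqrt{\lambda_k}}\Big)\varphi_k,\qquad v(t)=\sum_{k}\Big(-\sqrt{\lambda_k}\langle w_0,\varphi_k\rangle\sin(\sqrt{\lambda_k}t)+\langle v_0,\varphi_k\rangle\cos(\sqrt{\lambda_k}t)\Big)\varphi_k,$$ the quotient being read as $t$ for $k=0$. Theorem. Let $(w_0,\dot w_0)\in H^1\times L^2(\mathbb T^d)$ be such that either (a) $w_0\neq0$ and $\langle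 w_0,e^{ik\cdot x}\rangle_{L^2}=0$ for all but finitely many $k\in\mathbb Z^d$, or (b) $w_0=0$, $\dot w_0\neq0$ and $\langle\dot w_0,e^{ik\cdot x}\rangle_{L^2}=0$ for all but finitely many $k\in\mathbb Z^d$. Then for every $(w_1,\dot w_1)\in H^1\times L^2(\mathbb T^d)$ and all $\varepsilon,T>0$ there exist a time $\tau\in[0,T)$ and a piecewise constant control $p:[0,\tau]\to\mathbb R^{2d+1}$ such that the solution $w$ of (1) with initial condition $(w,\partial_tw)(0)=(w_0,\dot w_0)$ satisfies $$\big\|(w(\cdot,\tau),\partial_tw(\cdot,\tau))-(w_1,\dot w_1)\big\|_{H^1\times L^2(\mathbb T^d)}<\varepsilon.$$ -/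

import Mathlib

open MeasureTheory Set
open scoped ENNReal ComplexConjugate

noncomputable section

namespace BilinearWave

instance two_pi_pos : Fact (0 < 2 * Real.pi) := ⟨Real.two_pi_pos⟩

/-- The torus `𝕋ᵈ = (ℝ / 2πℤ)ᵈ`; its `volume` is the Lebesgue measure, of total mass `(2π)ᵈ`. -/
abbrev Torus (d : ℕ) : Type := Fin d → AddCircle (2 * Real.pi)

/-- `L²(𝕋ᵈ, ℝ)`. -/
abbrev L2 (d : ℕ) : Type := Lp ℝ 2 (volume : Measure (Torus d))

/-- The eigenfunction `φ_k(x) = (2π)^{-d/2} e^{i k·x}` of `-Δ`. -/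
def phi {d : ℕ} (k : Fin d → ℤ) : C(Torus d, ℂ) where
  toFun x := (((2 * Real.pi) ^ (-(d : ℝ) / 2) : ℝ) : ℂ) * ∏ i, fourier (k i) (x i)

/-- `|k| = √λ_k`, where `λ_k = |k|² = ∑ k_i²` is the eigenvalue of `-Δ` at `φ_k`. -/
def freq {d : ℕ} (k : Fin d → ℤ) : ℝ := Real.sqrt (∑ i, (k i : ℝ) ^ 2)

/-- The Fourier coefficient `⟨f, φ_k⟩ = ∫ f(x) \overline{φ_k(x)} dx`. -/
def coef {d : ℕ} (f : L2 d) (k : Fin d → ℤ) : ℂ := ∫ x, (f x : ℂ) * conj (phi k x)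

/-- The real function `x ↦ Re (c φ_k(x))`. -/
def modeFun {d : ℕ} (k : Fin d → ℤ) (c : ℂ) : C(Torus d, ℝ) where
  toFun x := (c * phi k x).re

/-- `Re (c φ_k)` as an element of `L²(𝕋ᵈ, ℝ)`. If `f` is real valued then
`f = ∑ ⟨f, φ_k⟩ φ_k = ∑ Re (⟨f, φ_k⟩ φ_k)`. -/
def mode {d : ℕ} (k : Fin d → ℤ) (c : ℂ) : L2 d :=
  ContinuousMap.toLp 2 volume ℝ (modeFun k c)

/-! ### Elementary facts on Fourier coefficients -/

theorem coef_eq_inner {d : ℕ} (f : L2 d) (k : Fin d → ℤ) :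
    coef f k = ((inner ℝ (mode k 1) f : ℝ) : ℂ)
      + ((inner ℝ (mode k Complex.I) f : ℝ) : ℂ) * Complex.I := by
  have key : ∀ c : ℂ, inner ℝ (mode k c) f = ∫ x, f x * (c * phi k x).re := by
    intro c
    rw [L2.inner_def]
    refine integral_congr_ae ?_
    filter_upwards [ContinuousMap.coeFn_toLp (p := 2) (𝕜 := ℝ) volume (modeFun k c)] with x hx
    rw [mode, hx]
    rfl
  have hint : ∀ c : ℂ, Integrable (fun x => f x * (c * phi k x).re) := by
    intro c
    have := L2.integrable_inner (𝕜 := ℝ) (mode k c) f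
    refine this.congr ?_
    filter_upwards [ContinuousMap.coeFn_toLp (p := 2) (𝕜 := ℝ) volume (modeFun k c)] with x hx
    rw [mode, hx]
    rfl
  rw [key, key, ← integral_complex_ofReal, ← integral_complex_ofReal, ← integral_mul_const,
    ← integral_add (hint 1).ofReal ((hint Complex.I).ofReal.mul_const _)]
  refine integral_congr_ae (Filter.Eventually.of_forall fun x => ?_)
  apply Complex.ext <;> simp

theorem continuous_coef {d : ℕ} (k : Fin d → ℤ) : Continuous fun f : L2 d => coef f k := by
  simp only [coef_eq_inner]
  fun_prop

theorem coef_add {d : ℕ} (f g : L2 d) (k : Fin d → ℤ) :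
    coef (f + g) k = coef f k + coef g k := by
  simp only [coef_eq_inner, inner_add_right, Complex.ofReal_add]
  ring

theorem coef_smul {d : ℕ} (a : ℝ) (f : L2 d) (k : Fin d → ℤ) :
    coef (a • f) k = (a : ℂ) * coef f k := by
  simp only [coef_eq_inner, inner_smul_right, Complex.ofReal_mul]
  ring

theorem coef_zero {d : ℕ} (k : Fin d → ℤ) : coef (0 : L2 d) k = 0 := by
  simp [coef_eq_inner]

theorem integral_phi {d : ℕ} {k : Fin d → ℤ} (hk : k ≠ 0) : ∫ x, phi k x = 0 := by
  obtain ⟨i, hi⟩ := Function.ne_iff.1 hk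
  have h1 : ∫ t : AddCircle (2 * Real.pi), fourier (k i) t = 0 := by
    have h := (orthonormal_iff_ite.1 (orthonormal_fourier (T := 2 * Real.pi))) 0 (k i)
    rw [if_neg (fun h => hi h.symm), fourierLp, fourierLp, ContinuousMap.inner_toLp] at h
    rw [AddCircle.volume_eq_smul_haarAddCircle, integral_smul_measure]
    simp only [fourier_zero, map_one, mul_one] at h
    rw [h, smul_zero]
  have h2 : ∫ x : Torus d, ∏ i, fourier (k i) (x i) = 0 := by
    rw [integral_fintype_prod_volume_eq_prod (fun i (t : AddCircle (2 * Real.pi)) => fourier (k i) t)]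
    exact Finset.prod_eq_zero (Finset.mem_univ i) h1
  simp only [phi, ContinuousMap.coe_mk, integral_const_mul, h2, mul_zero]

theorem coef_mode_eq_zero {d : ℕ} (k j : Fin d → ℤ) (c : ℂ) (h1 : j ≠ k) (h2 : j ≠ -k) :
    coef (mode k c) j = 0 := by
  set A : ℝ := (2 * Real.pi) ^ (-(d : ℝ) / 2) with hA
  have e1 : ∀ x : Torus d, ((modeFun k c x : ℝ) : ℂ) * conj (phi j x)
      = c / 2 * A * phi (k - j) x + conj c / 2 * A * phi (-k - j) x := by
    intro x
    have hre : ((modeFun k c x : ℝ) : ℂ) = (c * phi k x + conj (c * phi k x)) / 2 := by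
      exact Complex.re_eq_add_conj _
    rw [hre]
    simp only [phi, ContinuousMap.coe_mk, map_mul, map_prod, Complex.conj_ofReal, ← fourier_neg,
      ← hA, Pi.sub_apply, Pi.neg_apply, sub_eq_add_neg, fourier_add, Finset.prod_mul_distrib]
    ring
  have hint : ∀ m : Fin d → ℤ, Integrable (fun x => phi m x) := fun m =>
    (phi m).continuous.integrable_of_hasCompactSupport (HasCompactSupport.of_compactSpace _)
  calc coef (mode k c) j
      = ∫ x, ((modeFun k c x : ℝ) : ℂ) * conj (phi j x) := by
        refine integral_congr_ae ?_
        filter_upwards [ContinuousMap.coeFn_toLp (p := 2) (𝕜 := ℝ) volume (modeFun k c)] with x hx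
        rw [mode, hx]
    _ = ∫ x, (c / 2 * A * phi (k - j) x + conj c / 2 * A * phi (-k - j) x) := by
        simp only [e1]
    _ = 0 := by
        rw [integral_add ((hint _).const_mul _) ((hint _).const_mul _), integral_const_mul,
          integral_const_mul, integral_phi (sub_ne_zero.2 h1.symm),
          integral_phi (sub_ne_zero.2 h2.symm)]
        simp

/-! ### The Sobolev space `H¹(𝕋ᵈ, ℝ)` -/

/-- The weighted coefficients `|k| ⟨f, φ_k⟩`. -/
def wcoef {d : ℕ} (f : L2 d) (k : Fin d → ℤ) : ℂ := (freq k : ℂ) * coef f k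

/-- The functions `f ∈ L²(𝕋ᵈ, ℝ)` with `∑ λ_k |⟨f, φ_k⟩|² < ∞`. -/
def H1Submodule (d : ℕ) : Submodule ℝ (L2 d) where
  carrier := {f | Summable fun k : Fin d → ℤ => freq k ^ 2 * ‖coef f k‖ ^ 2}
  zero_mem' := by simp [coef_zero]
  add_mem' := by
    intro f g hf hg
    refine Summable.of_nonneg_of_le (fun k => by positivity) (fun k => ?_)
      ((hf.mul_left 2).add (hg.mul_left 2))
    rw [coef_add]
    have h := norm_add_le (coef f k) (coef g k)
    have h' : ‖coef f k + coef g k‖ ^ 2 ≤ 2 * ‖coef f k‖ ^ 2 + 2 * ‖coef g k‖ ^ 2 := by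
      nlinarith [norm_nonneg (coef f k + coef g k), sq_nonneg (‖coef f k‖ - ‖coef g k‖)]
    nlinarith [mul_le_mul_of_nonneg_left h' (sq_nonneg (freq k))]
  smul_mem' := by
    intro a f hf
    refine (hf.mul_left (a ^ 2)).congr fun k => ?_
    rw [coef_smul, norm_mul, mul_pow, Complex.norm_real, Real.norm_eq_abs, sq_abs]
    ring

/-- `H¹(𝕋ᵈ, ℝ)`; its norm, defined below, is not the one of `L²`. -/
def H1 (d : ℕ) : Type := ↥(H1Submodule d)

namespace H1

instance (d : ℕ) : AddCommGroup (H1 d) := inferInstanceAs (AddCommGroup ↥(H1Submodule d))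

instance (d : ℕ) : Module ℝ (H1 d) := inferInstanceAs (Module ℝ ↥(H1Submodule d))

/-- The inclusion `H¹ ⊆ L²`. -/
def toL2 {d : ℕ} : H1 d →ₗ[ℝ] L2 d := (H1Submodule d).subtype

theorem memlp_wcoef {d : ℕ} (u : H1 d) : Memℓp (wcoef (toL2 u)) 2 := by
  refine memℓp_gen ?_
  refine (show Summable _ from u.2).congr fun k => ?_
  simp [wcoef, mul_pow, sq_abs]
  exact Or.inl rfl

/-- The map `u ↦ (u, (|k| ⟨u, φ_k⟩)_k)` into the Hilbert space `L² × ℓ²(ℤᵈ)`. -/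
def embed (d : ℕ) :
    H1 d →ₗ[ℝ] WithLp 2 (L2 d × lp (fun _ : Fin d → ℤ => ℂ) 2) where
  toFun u := WithLp.toLp 2 (toL2 u, ⟨wcoef (toL2 u), memlp_wcoef u⟩)
  map_add' u v := by
    apply (WithLp.ofLp_injective 2)
    refine Prod.ext (by simp) (lp.ext (funext fun k => ?_))
    change wcoef (toL2 (u + v)) k = wcoef (toL2 u) k + wcoef (toL2 v) k
    simp [wcoef, coef_add, mul_add]
  map_smul' a u := by
    apply (WithLp.ofLp_injective 2)
    refine Prod.ext (by simp) (lp.ext (funext fun k => ?_))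
    simp [wcoef, coef_smul]
    ring

theorem embed_injective (d : ℕ) : Function.Injective (embed d) := by
  intro u v h
  exact Subtype.ext (congrArg (fun z => (WithLp.ofLp z).1) h)

/-- The norm `‖u‖_{H¹}² = ‖u‖_{L²}² + ∑ λ_k |⟨u, φ_k⟩|²`. -/
instance (d : ℕ) : NormedAddCommGroup (H1 d) :=
  NormedAddCommGroup.induced (H1 d) _ (embed d) (embed_injective d)

instance (d : ℕ) : NormedSpace ℝ (H1 d) := NormedSpace.induced ℝ (H1 d) _ (embed d)

theorem norm_sq_eq {d : ℕ} (u : H1 d) :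
    ‖u‖ ^ 2 = ‖toL2 u‖ ^ 2 + ∑' k : Fin d → ℤ, freq k ^ 2 * ‖coef (toL2 u) k‖ ^ 2 := by
  have h : ‖u‖ = ‖embed d u‖ := rfl
  rw [h, WithLp.prod_norm_sq_eq_of_L2]
  congr 1
  have h2 := lp.norm_rpow_eq_tsum (p := 2) (by norm_num)
    (⟨wcoef (toL2 u), memlp_wcoef u⟩ : lp (fun _ : Fin d → ℤ => ℂ) 2)
  simp only [ENNReal.toReal_ofNat, Real.rpow_ofNat] at h2
  refine h2.trans (tsum_congr fun k => ?_)
  simp [wcoef, mul_pow, sq_abs]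

instance (d : ℕ) : CompleteSpace (H1 d) := by
  have hiso : Isometry (embed d) := AddMonoidHomClass.isometry_of_norm (embed d) fun _ => rfl
  have hrange : Set.range (embed d) = {z : WithLp 2 (L2 d × lp (fun _ : Fin d → ℤ => ℂ) 2) |
      ∀ k, (WithLp.ofLp z).2 k = wcoef (WithLp.ofLp z).1 k} := by
    ext z
    constructor
    · rintro ⟨u, rfl⟩ k
      rfl
    · intro hz
      have hmem : (WithLp.ofLp z).1 ∈ H1Submodule d := by
        have := (lp.memℓp (WithLp.ofLp z).2).summable (by norm_num)
        refine this.congr fun k => ?_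
        rw [hz k]
        simp [wcoef, mul_pow, sq_abs]
      refine ⟨⟨(WithLp.ofLp z).1, hmem⟩, WithLp.ofLp_injective 2 ?_⟩
      exact Prod.ext rfl (lp.ext (funext fun k => (hz k).symm))
  have hclosed : IsClosed (Set.range (embed d)) := by
    rw [hrange, Set.ofPred_forall]
    refine isClosed_iInter fun k => isClosed_eq ?_ ?_
    · have h1 : Continuous fun a : lp (fun _ : Fin d → ℤ => ℂ) 2 => a k :=
        (continuous_apply k).comp (lp.uniformContinuous_coe (p := 2)).continuous
      exact h1.comp (continuous_snd.comp (WithLp.prod_continuous_ofLp 2 _ _))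
    · exact continuous_const.mul
        ((continuous_coef k).comp (continuous_fst.comp (WithLp.prod_continuous_ofLp 2 _ _)))
  exact (completeSpace_iff_isComplete_range hiso.isUniformInducing).2 hclosed.isComplete

/-- `Re (c φ_k)` as an element of `H¹(𝕋ᵈ, ℝ)`. -/
def mode {d : ℕ} (k : Fin d → ℤ) (c : ℂ) : H1 d :=
  ⟨BilinearWave.mode k c, by
    refine summable_of_ne_finset_zero (s := {k, -k}) fun j hj => ?_
    simp only [Finset.mem_insert, Finset.mem_singleton, not_or] at hj
    rw [coef_mode_eq_zero k j c hj.1 hj.2]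
    simp⟩

end H1

/-! ### The control system -/

/-- The state space `H¹ × L²(𝕋ᵈ, ℝ)` of pairs (profile, velocity). -/
abbrev State (d : ℕ) : Type := H1 d × L2 d

/-- The norm `(‖w‖_{H¹}² + ‖v‖_{L²}²)^{1/2}` of `H¹ × L²`. It is equivalent to the norm that Mathlib
puts on the product, which is used only for continuity and integrals. -/
def energyNorm {d : ℕ} (W : State d) : ℝ := Real.sqrt (‖W.1‖ ^ 2 + ‖W.2‖ ^ 2)

/-- `sin(√λ_k t) / √λ_k`, read as `t` for `k = 0`. -/
def sinDiv {d : ℕ} (k : Fin d → ℤ) (t : ℝ) : ℝ :=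
  if k = 0 then t else Real.sin (freq k * t) / freq k

/-- The free evolution `e^{t𝒜}(w₀, v₀)`, given by its Fourier series, converging in `H¹ × L²`:
`w(t) = ∑ (⟨w₀, φ_k⟩ cos(√λ_k t) + ⟨v₀, φ_k⟩ sin(√λ_k t)/√λ_k) φ_k`,
`∂ₜw(t) = ∑ (-√λ_k ⟨w₀, φ_k⟩ sin(√λ_k t) + ⟨v₀, φ_k⟩ cos(√λ_k t)) φ_k`. -/
def freeEvolution {d : ℕ} (t : ℝ) (W : State d) : State d :=
  (∑' k : Fin d → ℤ, H1.mode k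
      (coef W.1.toL2 k * (Real.cos (freq k * t) : ℝ) + coef W.2 k * (sinDiv k t : ℝ)),
   ∑' k : Fin d → ℤ, mode k
      (-(freq k : ℂ) * coef W.1.toL2 k * (Real.sin (freq k * t) : ℝ)
        + coef W.2 k * (Real.cos (freq k * t) : ℝ)))

/-- The function `x ↦ cos x_i` on the torus. -/
def cosFun {d : ℕ} (i : Fin d) : C(Torus d, ℝ) where
  toFun x := Real.Angle.cos (x i)
  continuous_toFun := Real.Angle.continuous_cos.comp (continuous_apply i)

/-- The function `x ↦ sin x_i` on the torus. -/
def sinFun {d : ℕ} (i : Fin d) : C(Torus d, ℝ) where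
  toFun x := Real.Angle.sin (x i)
  continuous_toFun := Real.Angle.continuous_sin.comp (continuous_apply i)

/-- `(μ_0, …, μ_{2d}) = (1, cos x_1, sin x_1, …, cos x_d, sin x_d)`. -/
def mu {d : ℕ} (j : Fin (2 * d + 1)) : C(Torus d, ℝ) :=
  if hj : j = 0 then 1
  else
    have hlt : ((j : ℕ) - 1) / 2 < d := by
      have h0 : (j : ℕ) ≠ 0 := fun h => hj (Fin.ext h)
      have := j.isLt
      omega
    if Odd (j : ℕ) then cosFun ⟨((j : ℕ) - 1) / 2, hlt⟩
    else sinFun ⟨((j : ℕ) - 1) / 2, hlt⟩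

/-- The product of a continuous function with an element of `L²`. -/
def mulL2 {d : ℕ} (m : C(Torus d, ℝ)) (f : L2 d) : L2 d :=
  (ContinuousMap.toLp ∞ volume ℝ m : Lp ℝ ∞ (volume : Measure (Torus d))) • f

/-- The operator `(∑_j q_j μ_j) ℬ : (w, v) ↦ (0, (∑_j q_j μ_j) w)`. -/
def controlOp {d : ℕ} (q : Fin (2 * d + 1) → ℝ) (W : State d) : State d :=
  (0, mulL2 (∑ j, q j • mu j) W.1.toL2)

/-- `W` is the (mild) solution on `[0, τ]` of
`∂ₜ²w = (Δ + ∑_j p_j(t) μ_j) w`, `(w, ∂ₜw)(0) = W₀`, with `W = (w, ∂ₜw)`: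
it is continuous with values in `H¹ × L²` and satisfies
`W(t) = e^{t𝒜} W₀ + ∫₀ᵗ e^{(t-s)𝒜} (∑_j p_j(s) μ_j) ℬ W(s) ds`. -/
structure IsSolution {d : ℕ} (τ : ℝ) (p : ℝ → Fin (2 * d + 1) → ℝ) (W₀ : State d)
    (W : ℝ → State d) : Prop where
  continuousOn : ContinuousOn W (Icc 0 τ)
  duhamel : ∀ t ∈ Icc 0 τ,
    IntervalIntegrable (fun s => freeEvolution (t - s) (controlOp (p s) (W s))) volume 0 t ∧
    W t = freeEvolution t W₀ + ∫ s in (0 : ℝ)..t, freeEvolution (t - s) (controlOp (p s) (W s))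

/-- `p : [0, τ] → E` is piecewise constant: there are times `0 = t_0 ≤ t_1 ≤ … ≤ t_n = τ` such that
`p` is constant on every open interval `(t_i, t_{i+1})`. -/
def IsPiecewiseConstant {E : Type*} (τ : ℝ) (p : ℝ → E) : Prop :=
  ∃ (n : ℕ) (t : ℕ → ℝ), Monotone t ∧ t 0 = 0 ∧ t n = τ ∧
    ∀ i < n, ∃ c : E, ∀ s ∈ Ioo (t i) (t (i + 1)), p s = c

/-- `⟨f, e^{ik·x}⟩ = 0` for all but finitely many `k ∈ ℤᵈ`. -/
def FinitelyManyModes {d : ℕ} (f : L2 d) : Prop := {k : Fin d → ℤ | coef f k ≠ 0}.Finite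

end BilinearWave

end

open BilinearWave

noncomputable section

namespace BilinearWave

open Filter Topology

/-! ### Mild solutions for bounded perturbations of a strongly continuous group -/

section MildSolutions

open intervalIntegral

/-! The control operator only writes into the velocity and only reads the profile, so it squares to
zero. A control of size `δ⁻¹` on a time interval of length `δ` therefore acts in the limit as the
shear `(w, v) ↦ (w, v + f w)`, the exponential of a nilpotent operator (`IsMild.impulse_limit`).
Potentials `f` whose shear is approximately reachable in arbitrarily small time are called
`Kickable`; they form a set closed under addition that contains the span of the `μ_j`.

New potentials come from conjugating a short free evolution by large opposite kicks: kick by `s⁻¹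
φ`, wait for time `s²`, kick by `-s⁻¹ φ`. As `s → 0` this converges strongly to the kick by `-φ²`
(`tendsto_conjugated_waveGroup`). Applied to sums of two trigonometric functions, with the constant
potential absorbing the diagonal terms, it shows that the available frequencies are closed under
differences (`kickable_trig_sub`). Since they contain the coordinate vectors, they exhaust `ℤᵈ`
(`kickable_trig`).

A nonzero trigonometric polynomial `w` vanishes only on a null set (`ae_trig_sum_ne_zero`), so the
products of `w` with trigonometric polynomials are dense in `L²` (`span_mulL2_trig_closure_eq_top`),
and kicks bring the velocity close to any target while the profile stays fixed (`reachIn_velocity`).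
To move the profile from `w₀` to near `w`, prepare the velocity `t⁻¹ (w - w₀)` and evolve freely for
a short time `t`; the new profile is still a trigonometric polynomial, so its velocity can be
corrected at the end (`reachIn_of_profile_ne_zero`). If the initial profile is zero, a short free
evolution first makes it nonzero (`exists_sinOp_ne_zero`). -/

theorem le_mul_exp_of_le_add_integral {m : ℝ → ℝ} {τ a L : ℝ} (hL : 0 ≤ L)
    (hm : ContinuousOn m (Icc 0 τ))
    (h : ∀ t ∈ Icc 0 τ, m t ≤ a + L * ∫ s in (0 : ℝ)..t, m s) :
    ∀ t ∈ Icc 0 τ, m t ≤ a * Real.exp (L * t) := by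
  intro t ht
  have hτ : 0 ≤ τ := ht.1.trans ht.2
  -- Freezing `m` outside the interval makes the integrand continuous on all of `ℝ`, so its
  -- primitive is differentiable at the endpoints too and the differential Gronwall inequality
  -- applies.
  obtain ⟨M, hM, hMc⟩ : ∃ M : ℝ → ℝ, (∀ t ∈ Icc 0 τ, M t = m t) ∧ Continuous M :=
    ⟨fun t => m (projIcc 0 τ hτ t), fun t ht => by simp [projIcc_of_mem hτ ht],
      hm.comp_continuous (continuous_subtype_val.comp continuous_projIcc) fun x =>
        (projIcc 0 τ hτ x).2⟩
  have hint : ∀ t ∈ Icc 0 τ, ∫ s in (0 : ℝ)..t, m s = ∫ s in (0 : ℝ)..t, M s := by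
    intro t ht
    refine integral_congr fun s hs => ?_
    rw [uIcc_of_le ht.1] at hs
    exact (hM s ⟨hs.1, hs.2.trans ht.2⟩).symm
  have key := le_gronwallBound_of_liminf_deriv_right_le (f := fun t => a + L * ∫ s in (0:ℝ)..t, M s)
    (f' := fun t => L * M t) (δ := a) (K := L) (ε := 0) (a := 0) (b := τ)
    (by
      refine Continuous.continuousOn ?_
      have := continuous_primitive (fun a b => hMc.intervalIntegrable a b) (0:ℝ) (μ := volume)
      fun_prop)
    (fun x hx r hr => by
      have hd : HasDerivAt (fun t => a + L * ∫ s in (0:ℝ)..t, M s) (L * M x) x :=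
        ((hMc.integral_hasStrictDerivAt 0 x).hasDerivAt.const_mul L).const_add a
      exact hd.hasDerivWithinAt.liminf_right_slope_le hr)
    (by simp)
    (fun x hx => by
      have hx' : x ∈ Icc 0 τ := ⟨hx.1, hx.2.le⟩
      have := h x hx'
      rw [hint x hx', ← hM x hx'] at this
      simpa using mul_le_mul_of_nonneg_left this hL)
    t ht
  rw [gronwallBound_ε0, sub_zero] at key
  refine (h t ht).trans ?_
  rw [hint t ht]
  exact key

variable {X : Type*} [NormedAddCommGroup X] [NormedSpace ℝ X]

/-- A strongly continuous, locally bounded one-parameter group of operators. -/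
structure IsOperatorGroup (U : ℝ → X →L[ℝ] X) : Prop where
  zero : U 0 = 1
  add : ∀ s t x, U (s + t) x = U s (U t x)
  cont : ∀ x, Continuous fun t => U t x
  bdd : ∀ R : ℝ, ∃ M : ℝ, 0 ≤ M ∧ ∀ t, |t| ≤ R → ‖U t‖ ≤ M

/-- Mild solutions of `x' = A x + K(t) x`, where `A` generates the group `U`. -/
structure IsMild (U : ℝ → X →L[ℝ] X) (K : ℝ → X →L[ℝ] X) (τ : ℝ) (x₀ : X) (x : ℝ → X) : Prop where
  continuousOn : ContinuousOn x (Icc 0 τ)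
  duhamel : ∀ t ∈ Icc 0 τ,
    IntervalIntegrable (fun s => U (t - s) (K s (x s))) volume 0 t ∧
    x t = U t x₀ + ∫ s in (0 : ℝ)..t, U (t - s) (K s (x s))

variable {U : ℝ → X →L[ℝ] X}

/-- Strong continuity handles the frozen vector `y t₀`; the local bound on the operator norms
handles the remainder `y t - y t₀`. -/
theorem IsOperatorGroup.continuousOn_apply (hU : IsOperatorGroup U) {S : Set ℝ} {g : ℝ → ℝ}
    {y : ℝ → X} (hg : ContinuousOn g S) (hy : ContinuousOn y S) :
    ContinuousOn (fun t => U (g t) (y t)) S := by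
  intro t₀ ht₀
  obtain ⟨M, hM0, hM⟩ := hU.bdd (|g t₀| + 1)
  have h1 : Tendsto (fun t => U (g t) (y t₀)) (𝓝[S] t₀) (𝓝 (U (g t₀) (y t₀))) :=
    ((hU.cont (y t₀)).tendsto (g t₀)).comp (hg t₀ ht₀)
  have h2 : Tendsto (fun t => U (g t) (y t - y t₀)) (𝓝[S] t₀) (𝓝 0) := by
    have h3 : Tendsto (fun t => M * ‖y t - y t₀‖) (𝓝[S] t₀) (𝓝 0) := by
      have := ((hy t₀ ht₀).sub_const (y t₀)).norm.const_mul M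
      simpa using this
    refine squeeze_zero_norm' ?_ h3
    have h4 : ∀ᶠ t in 𝓝[S] t₀, |g t| < |g t₀| + 1 :=
      (hg t₀ ht₀).abs.eventually (gt_mem_nhds (by linarith))
    filter_upwards [h4] with t ht
    exact (U (g t)).le_of_opNorm_le (hM _ ht.le) _
  have := h1.add h2
  simp only [add_zero] at this
  refine this.congr fun t => ?_
  simp

/-- Gronwall applied to the difference of the two Duhamel formulas. It yields both uniqueness and
Lipschitz dependence on the initial state. -/
theorem IsMild.dist_le {K : ℝ → X →L[ℝ] X} {τ M B : ℝ} {x₀ y₀ : X}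
    {x y : ℝ → X} (hM0 : 0 ≤ M) (hM : ∀ t, |t| ≤ τ → ‖U t‖ ≤ M) (hB0 : 0 ≤ B)
    (hB : ∀ s, ‖K s‖ ≤ B) (hx : IsMild U K τ x₀ x) (hy : IsMild U K τ y₀ y) :
    ∀ t ∈ Icc 0 τ, ‖x t - y t‖ ≤ M * ‖x₀ - y₀‖ * Real.exp (M * B * t) := by
  refine le_mul_exp_of_le_add_integral (m := fun t => ‖x t - y t‖) (by positivity)
    (hx.continuousOn.sub hy.continuousOn).norm fun t ht => ?_
  obtain ⟨ix, ex⟩ := hx.duhamel t ht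
  obtain ⟨iy, ey⟩ := hy.duhamel t ht
  have e : x t - y t = U t (x₀ - y₀) + ∫ s in (0 : ℝ)..t, U (t - s) (K s (x s - y s)) := by
    rw [ex, ey, map_sub]
    simp only [map_sub]
    rw [integral_sub ix iy]
    abel
  have hc : ContinuousOn (fun s => ‖x s - y s‖) (uIcc 0 t) := by
    rw [uIcc_of_le ht.1]
    exact ((hx.continuousOn.sub hy.continuousOn).norm).mono (Icc_subset_Icc_right ht.2)
  rw [e]
  refine (norm_add_le _ _).trans (add_le_add ?_ ?_)
  · exact (U t).le_of_opNorm_le (hM _ (by rw [abs_of_nonneg ht.1]; exact ht.2)) _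
  · rw [← intervalIntegral.integral_const_mul]
    refine intervalIntegral.norm_integral_le_of_norm_le ht.1 ?_
      (hc.intervalIntegrable.const_mul _)
    refine Eventually.of_forall fun s hs => ?_
    have h1 := (U (t - s)).le_of_opNorm_le
      (hM _ (by rw [abs_of_nonneg (by linarith [hs.2])]; linarith [hs.1, ht.2])) (K s (x s - y s))
    have h2 := (K s).le_of_opNorm_le (hB s) (x s - y s)
    calc _ ≤ M * ‖K s (x s - y s)‖ := h1
      _ ≤ M * (B * ‖x s - y s‖) := by gcongr
      _ = _ := by ring

/-- Past the junction the Duhamel integral splits at `τ₁`, and the group law moves the first piece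
into the initial value of the second solution. -/
theorem IsMild.concat [CompleteSpace X] (hU : IsOperatorGroup U) {K₁ K₂ : ℝ → X →L[ℝ] X}
    {τ₁ τ₂ : ℝ} {x₀ : X} {x y : ℝ → X} (h₁ : 0 ≤ τ₁) (h₂ : 0 ≤ τ₂) (hx : IsMild U K₁ τ₁ x₀ x)
    (hy : IsMild U K₂ τ₂ (x τ₁) y) :
    IsMild U (fun s => if s < τ₁ then K₁ s else K₂ (s - τ₁)) (τ₁ + τ₂) x₀
      (fun t => if t ≤ τ₁ then x t else y (t - τ₁)) := by
  have hy0 : y 0 = x τ₁ := by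
    have := (hy.duhamel 0 ⟨le_rfl, h₂⟩).2
    simpa [hU.zero] using this
  -- The integrands are compared on open intervals only: the value at the junction is irrelevant to
  -- the integrals.
  have hcongr₁ : ∀ t ∈ Icc 0 τ₁, ∀ r : ℝ, EqOn
      (fun s => U (r - s) ((if s < τ₁ then K₁ s else K₂ (s - τ₁)) (if s ≤ τ₁ then x s else y (s - τ₁))))
      (fun s => U (r - s) (K₁ s (x s))) (Ioo 0 t) := by
    intro t ht r s hs
    have : s < τ₁ := hs.2.trans_le ht.2
    simp [this, this.le]
  have hcongr₂ : ∀ t, ∀ r : ℝ, EqOn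
      (fun s => U (r - s) ((if s < τ₁ then K₁ s else K₂ (s - τ₁)) (if s ≤ τ₁ then x s else y (s - τ₁))))
      (fun s => U (r - s) (K₂ (s - τ₁) (y (s - τ₁)))) (Ioo τ₁ t) := by
    intro t r s hs
    have : τ₁ < s := hs.1
    simp [this.not_ge, this.not_gt]
  refine ⟨?_, fun t ht => ?_⟩
  · have hfr : ∀ a ∈ Icc 0 (τ₁ + τ₂) ∩ frontier {t | t ≤ τ₁}, x a = y (a - τ₁) := by
      rintro a ⟨_, ha⟩
      have : a = τ₁ := by
        have := frontier_Iic (α := ℝ) (a := τ₁)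
        rw [show {t | t ≤ τ₁} = Iic τ₁ from rfl, this] at ha
        exact ha
      rw [this, sub_self, hy0]
    refine ContinuousOn.if hfr ?_ ?_
    · refine hx.continuousOn.mono ?_
      rintro a ⟨ha, hb⟩
      rw [show {t | t ≤ τ₁} = Iic τ₁ from rfl, closure_Iic] at hb
      exact ⟨ha.1, hb⟩
    · refine hy.continuousOn.comp (by fun_prop) ?_
      rintro a ⟨ha, hb⟩
      have hb : a ∈ Ici τ₁ := by
        rw [show {t | ¬ t ≤ τ₁} = Ioi τ₁ by ext; simp, closure_Ioi] at hb
        exact hb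
      have h1 := ha.2
      have h2 : τ₁ ≤ a := hb
      constructor <;> linarith
  · rcases le_or_gt t τ₁ with htτ | htτ
    · obtain ⟨ix, ex⟩ := hx.duhamel t ⟨ht.1, htτ⟩
      have hc := hcongr₁ t ⟨ht.1, htτ⟩ t
      refine ⟨?_, ?_⟩
      · rw [intervalIntegrable_iff_integrableOn_Ioo_of_le ht.1] at ix ⊢
        exact ix.congr_fun hc.symm measurableSet_Ioo
      · rw [if_pos htτ, ex]
        congr 1
        rw [integral_of_le ht.1, integral_of_le ht.1, integral_Ioc_eq_integral_Ioo,
          integral_Ioc_eq_integral_Ioo]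
        exact setIntegral_congr_fun measurableSet_Ioo hc.symm
    · obtain ⟨ix, ex⟩ := hx.duhamel τ₁ ⟨h₁, le_rfl⟩
      obtain ⟨iy, ey⟩ := hy.duhamel (t - τ₁) ⟨by linarith, by linarith [ht.2]⟩
      have hc₁ := hcongr₁ τ₁ ⟨h₁, le_rfl⟩ t
      have hc₂ := hcongr₂ t t
      have hUx : ∀ s, U (t - s) (K₁ s (x s)) = U (t - τ₁) (U (τ₁ - s) (K₁ s (x s))) := by
        intro s
        rw [← hU.add]
        ring_nf
      have ix' : IntervalIntegrable (fun s => U (t - s) (K₁ s (x s))) volume 0 τ₁ := by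
        simp only [hUx]
        rw [intervalIntegrable_iff] at ix ⊢
        exact (U (t - τ₁)).integrable_comp ix
      have hUy : ∀ s, U (t - s) (K₂ (s - τ₁) (y (s - τ₁)))
          = (fun s => U (t - τ₁ - s) (K₂ s (y s))) (s - τ₁) := by
        intro s
        simp
      have iy' : IntervalIntegrable (fun s => U (t - s) (K₂ (s - τ₁) (y (s - τ₁)))) volume τ₁ t := by
        simp only [hUy]
        have := iy.comp_sub_right τ₁
        simpa using this
      have I₁ : IntervalIntegrable (fun s => U (t - s) ((if s < τ₁ then K₁ s else K₂ (s - τ₁))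
          (if s ≤ τ₁ then x s else y (s - τ₁)))) volume 0 τ₁ := by
        rw [intervalIntegrable_iff_integrableOn_Ioo_of_le h₁] at ix' ⊢
        exact ix'.congr_fun hc₁.symm measurableSet_Ioo
      have I₂ : IntervalIntegrable (fun s => U (t - s) ((if s < τ₁ then K₁ s else K₂ (s - τ₁))
          (if s ≤ τ₁ then x s else y (s - τ₁)))) volume τ₁ t := by
        rw [intervalIntegrable_iff_integrableOn_Ioo_of_le htτ.le] at iy' ⊢
        exact iy'.congr_fun hc₂.symm measurableSet_Ioo
      refine ⟨I₁.trans I₂, ?_⟩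
      rw [← integral_add_adjacent_intervals I₁ I₂, if_neg htτ.not_ge, ey, ex, map_add,
        ← hU.add, add_assoc]
      congr 1
      · ring_nf
      congr 1
      · rw [← (U (t - τ₁)).intervalIntegral_comp_comm ix]
        simp only [← hUx]
        rw [integral_of_le h₁, integral_of_le h₁, integral_Ioc_eq_integral_Ioo,
          integral_Ioc_eq_integral_Ioo]
        exact setIntegral_congr_fun measurableSet_Ioo hc₁.symm
      · have : ∫ s in (0:ℝ)..(t - τ₁), U (t - τ₁ - s) (K₂ s (y s))
            = ∫ s in τ₁..t, U (t - s) (K₂ (s - τ₁) (y (s - τ₁))) := by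
          simp only [hUy]
          rw [intervalIntegral.integral_comp_sub_right (fun s => U (t - τ₁ - s) (K₂ s (y s)))]
          simp
        rw [this, integral_of_le htτ.le, integral_of_le htτ.le, integral_Ioc_eq_integral_Ioo,
          integral_Ioc_eq_integral_Ioo]
        exact setIntegral_congr_fun measurableSet_Ioo hc₂.symm

/-- In the interaction picture `z t = U (-t) (x t)` the unbounded generator disappears: Duhamel's
formula becomes the integral form of `z' = U (-t) K U t z`, a linear equation with bounded
coefficients to which Picard–Lindelöf applies. -/
theorem exists_isMild [CompleteSpace X] (hU : IsOperatorGroup U) (K : X →L[ℝ] X) {δ M : ℝ}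
    (hδ : 0 ≤ δ) (hM0 : 0 ≤ M) (hM : ∀ t, |t| ≤ δ → ‖U t‖ ≤ M) (hsmall : M * M * ‖K‖ * δ ≤ 1 / 2)
    (x₀ : X) : ∃ x, IsMild U (fun _ => K) δ x₀ x := by
  obtain ⟨C, hC⟩ : ∃ C : NNReal, (C : ℝ) = M * M * ‖K‖ :=
    ⟨Real.toNNReal (M * M * ‖K‖), Real.coe_toNNReal _ (by positivity)⟩
  have hMt : ∀ t ∈ Icc 0 δ, ‖U t‖ ≤ M ∧ ‖U (-t)‖ ≤ M := fun t ht =>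
    ⟨hM t (by rw [abs_of_nonneg ht.1]; exact ht.2),
      hM (-t) (by rw [abs_neg, abs_of_nonneg ht.1]; exact ht.2)⟩
  have hnorm : ∀ t ∈ Icc 0 δ, ∀ z, ‖U (-t) (K (U t z))‖ ≤ C * ‖z‖ := by
    intro t ht z
    calc _ ≤ M * ‖K (U t z)‖ := (U (-t)).le_of_opNorm_le (hMt t ht).2 _
      _ ≤ M * (‖K‖ * ‖U t z‖) := by gcongr; exact K.le_opNorm _
      _ ≤ M * (‖K‖ * (M * ‖z‖)) := by gcongr; exact (U t).le_of_opNorm_le (hMt t ht).1 _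
      _ = C * ‖z‖ := by rw [hC]; ring
  have hcontF : ∀ z : ℝ → X, ContinuousOn z (Icc 0 δ) →
      ContinuousOn (fun t => U (-t) (K (U t (z t)))) (Icc 0 δ) := fun z hz =>
    hU.continuousOn_apply (by fun_prop)
      (K.continuous.comp_continuousOn (hU.continuousOn_apply continuousOn_id hz))
  -- On the ball of radius `‖x₀‖ + 1` about `x₀` the field is at most `C (2‖x₀‖ + 1)`. Since `C δ ≤
  -- 1/2`, solutions stay in the ball up to time `δ`.
  have hPL : IsPicardLindelof (tmin := 0) (tmax := δ) (fun t z => U (-t) (K (U t z)))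
      ⟨0, le_rfl, hδ⟩ x₀ (‖x₀‖₊ + 1) 0 (C * (2 * ‖x₀‖₊ + 1)) C := by
    refine ⟨fun t ht => ?_, fun z _ => hcontF _ continuousOn_const, fun t ht z hz => ?_, ?_⟩
    · refine LipschitzWith.lipschitzOnWith (LipschitzWith.of_dist_le_mul fun z z' => ?_)
      rw [dist_eq_norm, dist_eq_norm]
      simpa using hnorm t ht (z - z')
    · refine (hnorm t ht z).trans ?_
      push_cast
      have : ‖z‖ ≤ ‖x₀‖ + (‖x₀‖ + 1) := by
        have h1 := norm_le_norm_add_norm_sub x₀ z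
        have h2 : ‖x₀ - z‖ ≤ ‖x₀‖ + 1 := by
          have := Metric.mem_closedBall.1 hz
          rw [dist_comm, dist_eq_norm] at this
          simpa using this
        linarith
      have hC0 : (0:ℝ) ≤ C := C.2
      exact mul_le_mul_of_nonneg_left (by linarith) hC0
    · have : (C : ℝ) * δ ≤ 1 / 2 := by rwa [hC]
      simp only [sub_zero, sub_self, max_eq_left hδ]
      push_cast
      nlinarith [norm_nonneg x₀]
  -- The fixed point of the Picard map is used directly, because the integral equation is exactly
  -- what a mild solution requires.
  obtain ⟨α, hα⟩ := ODE.FunSpace.exists_isFixedPt_next hPL (x := x₀) (by simp)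
  set z := α.compProj with hzdef
  have hz : ∀ t ∈ Icc 0 δ, z t = ODE.picard (fun t z => U (-t) (K (U t z))) 0 x₀ z t := by
    intro t ht
    have h1 := congrArg (fun β : ODE.FunSpace _ _ _ _ => β.compProj t) hα.eq
    rw [hzdef, ← h1, ODE.FunSpace.compProj_apply, ODE.FunSpace.next_apply, projIcc_of_mem _ ht]
  have hzc : ContinuousOn z (Icc 0 δ) := α.continuous_compProj.continuousOn
  have hFc := hcontF z hzc
  refine ⟨fun t => U t (z t), hU.continuousOn_apply continuousOn_id hzc, fun t ht => ?_⟩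
  have hrw : ∀ s, U (t - s) (K (U s (z s))) = U t (U (-s) (K (U s (z s)))) := by
    intro s
    rw [← hU.add, sub_eq_add_neg]
  have hi : IntervalIntegrable (fun s => U (-s) (K (U s (z s)))) volume 0 t := by
    refine ContinuousOn.intervalIntegrable ?_
    rw [uIcc_of_le ht.1]
    exact hFc.mono (Icc_subset_Icc_right ht.2)
  simp only [hrw]
  refine ⟨?_, ?_⟩
  · rw [intervalIntegrable_iff] at hi ⊢
    exact (U t).integrable_comp hi
  · rw [(U t).intervalIntegral_comp_comm hi, ← map_add]
    congr 1
    exact hz t ht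

/-- Compare with the affine curve `x₀ + (t/δ) K x₀`, which solves the equation without the free part
because `K² = 0`. The free group is close to the identity on `x₀` and `K x₀` for short times, and
the Gronwall factor `exp (M ‖K‖)` does not depend on `δ`. -/
theorem IsMild.impulse_limit [CompleteSpace X] (hU : IsOperatorGroup U) {K : X →L[ℝ] X} (hK : ∀ x, K (K x) = 0)
    (x₀ : X) {ε : ℝ} (hε : 0 < ε) : ∃ δ₀ > 0, ∀ δ, 0 < δ → δ < δ₀ → ∀ x : ℝ → X,
      IsMild U (fun _ => δ⁻¹ • K) δ x₀ x → ‖x δ - (x₀ + K x₀)‖ < ε := by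
  obtain ⟨M, hM0, hM⟩ := hU.bdd 1
  set E := Real.exp (M * ‖K‖) with hE
  have hEpos : 0 < E := Real.exp_pos _
  -- Two errors of size `η` enter, one from `x₀` and one from `K x₀`; after Gronwall they contribute
  -- `2 η E = ε / 2`.
  set η := ε / (4 * E) with hη
  have hηpos : 0 < η := by positivity
  have hsmall : ∀ y : X, ∃ r > 0, ∀ t, |t| < r → ‖U t y - y‖ ≤ η := by
    intro y
    have := (hU.cont y).tendsto 0
    rw [hU.zero, Metric.tendsto_nhds_nhds] at this
    obtain ⟨r, hr, h⟩ := this η hηpos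
    refine ⟨r, hr, fun t ht => ?_⟩
    have := h (x := t) (by simpa using ht)
    rw [dist_eq_norm] at this
    exact this.le
  obtain ⟨r₁, hr₁, h₁⟩ := hsmall x₀
  obtain ⟨r₂, hr₂, h₂⟩ := hsmall (K x₀)
  refine ⟨min 1 (min r₁ r₂), by positivity, fun δ hδ hδ' x hx => ?_⟩
  obtain ⟨hδ1, hδr₁, hδr₂⟩ : δ < 1 ∧ δ < r₁ ∧ δ < r₂ := by simpa using hδ'
  have hmem : δ ∈ Icc 0 δ := ⟨hδ.le, le_rfl⟩
  set y : ℝ → X := fun t => x₀ + (t / δ) • K x₀ with hy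
  have hKy : ∀ s, K (y s) = K x₀ := by
    intro s
    simp [hy, hK]
  have hyc : Continuous y := by fun_prop
  have hdc : ContinuousOn (fun t => ‖x t - y t‖) (Icc 0 δ) :=
    (hx.continuousOn.sub hyc.continuousOn).norm
  have key := le_mul_exp_of_le_add_integral (m := fun t => ‖x t - y t‖) (a := 2 * η)
    (L := M * (δ⁻¹ * ‖K‖)) (τ := δ) (by positivity) hdc ?_ δ hmem
  · have hyδ : y δ = x₀ + K x₀ := by simp [hy, hδ.ne']
    have he : M * (δ⁻¹ * ‖K‖) * δ = M * ‖K‖ := by field_simp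
    rw [he, ← hE] at key
    rw [← hyδ]
    refine key.trans_lt ?_
    rw [hη]
    field_simp
    linarith
  · intro t ht
    obtain ⟨ix, ex⟩ := hx.duhamel t ht
    have iy : IntervalIntegrable (fun s => U (t - s) ((δ⁻¹ • K) x₀)) volume 0 t :=
      ((hU.cont _).comp (by fun_prop)).intervalIntegrable _ _
    have hxy : ∀ s, U (t - s) ((δ⁻¹ • K) (x s - y s))
        = U (t - s) ((δ⁻¹ • K) (x s)) - U (t - s) ((δ⁻¹ • K) x₀) := by
      intro s
      rw [map_sub, map_sub]
      simp [hKy]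
    have hconst : ∫ s in (0:ℝ)..t, δ⁻¹ • K x₀ = (t / δ) • K x₀ := by
      rw [intervalIntegral.integral_const, smul_smul]
      congr 1
      simp [div_eq_mul_inv]
    have e : x t - y t = (U t x₀ - x₀) + (∫ s in (0 : ℝ)..t, U (t - s) ((δ⁻¹ • K) (x s - y s)))
        + ∫ s in (0:ℝ)..t, (U (t - s) ((δ⁻¹ • K) x₀) - δ⁻¹ • K x₀) := by
      simp only [hxy]
      rw [integral_sub ix iy, integral_sub iy intervalIntegrable_const, hconst, ex]
      simp only [hy]
      abel
    have hb1 : ‖U t x₀ - x₀‖ ≤ η := h₁ t (by rw [abs_of_nonneg ht.1]; linarith [ht.2])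
    have hb2 : ‖∫ s in (0 : ℝ)..t, U (t - s) ((δ⁻¹ • K) (x s - y s))‖
        ≤ M * (δ⁻¹ * ‖K‖) * ∫ s in (0 : ℝ)..t, ‖x s - y s‖ := by
      rw [← intervalIntegral.integral_const_mul]
      refine intervalIntegral.norm_integral_le_of_norm_le ht.1 ?_ ?_
      · refine Eventually.of_forall fun s hs => ?_
        have h1 := (U (t - s)).le_of_opNorm_le
          (hM _ (by rw [abs_of_nonneg (by linarith [hs.2])]; linarith [hs.1, ht.2]))
          ((δ⁻¹ • K) (x s - y s))
        refine h1.trans ?_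
        rw [smul_apply, norm_smul, Real.norm_of_nonneg (by positivity),
          mul_assoc M, mul_assoc δ⁻¹]
        gcongr
        exact K.le_opNorm _
      · refine ContinuousOn.intervalIntegrable ?_
        rw [uIcc_of_le ht.1]
        exact continuousOn_const.mul (hdc.mono (Icc_subset_Icc_right ht.2))
    have hb3 : ‖∫ s in (0:ℝ)..t, (U (t - s) ((δ⁻¹ • K) x₀) - δ⁻¹ • K x₀)‖ ≤ η := by
      have : ∀ s ∈ uIoc 0 t, ‖U (t - s) ((δ⁻¹ • K) x₀) - δ⁻¹ • K x₀‖ ≤ δ⁻¹ * η := by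
        intro s hs
        rw [uIoc_of_le ht.1] at hs
        rw [smul_apply, map_smul, ← smul_sub, norm_smul,
          Real.norm_of_nonneg (by positivity)]
        gcongr
        exact h₂ _ (by rw [abs_of_nonneg (by linarith [hs.2])]; linarith [hs.1, ht.2])
      refine (intervalIntegral.norm_integral_le_of_norm_le_const this).trans ?_
      rw [sub_zero, abs_of_nonneg ht.1]
      have : δ⁻¹ * t ≤ 1 := by
        rw [inv_mul_le_iff₀ hδ]
        linarith [ht.2]
      nlinarith
    show ‖x t - y t‖ ≤ _
    rw [e]
    refine (norm_add_le _ _).trans ?_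
    have := norm_add_le (U t x₀ - x₀) (∫ s in (0 : ℝ)..t, U (t - s) ((δ⁻¹ • K) (x s - y s)))
    linarith

end MildSolutions

/-! ### Fourier series on the torus -/

variable {d : ℕ}

/-- The character `x ↦ e^{ik·x}` of the torus. -/
def expo (k : Fin d → ℤ) : C(Torus d, ℂ) where
  toFun x := ∏ i, fourier (k i) (x i)

theorem expo_add (k m : Fin d → ℤ) (x : Torus d) : expo (k + m) x = expo k x * expo m x := by
  simp only [expo, Pi.add_apply, fourier_add, ContinuousMap.coe_mk, ← Finset.prod_mul_distrib]

theorem expo_neg (k : Fin d → ℤ) (x : Torus d) : expo (-k) x = conj (expo k x) := by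
  simp only [expo, Pi.neg_apply, fourier_neg, ContinuousMap.coe_mk, map_prod]

theorem expo_zero (x : Torus d) : expo 0 x = 1 := by
  simp [expo]

theorem expo_single (i : Fin d) (x : Torus d) : expo (Pi.single i 1) x = fourier 1 (x i) := by
  simp only [expo, ContinuousMap.coe_mk]
  rw [Finset.prod_eq_single i]
  · simp
  · intro j _ hj
    simp [Pi.single_eq_of_ne hj]
  · simp

theorem expo_mul_conj (k : Fin d → ℤ) (x : Torus d) : expo k x * conj (expo k x) = 1 := by
  rw [← expo_neg, ← expo_add, add_neg_cancel, expo_zero]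

/-- The normalization constant `(2π)^{-d/2}`. -/
def normConst (d : ℕ) : ℝ := (2 * Real.pi) ^ (-(d : ℝ) / 2)

theorem normConst_pos (d : ℕ) : 0 < normConst d := Real.rpow_pos_of_pos Real.two_pi_pos _

theorem phi_apply (k : Fin d → ℤ) (x : Torus d) : phi k x = (normConst d : ℂ) * expo k x := rfl

theorem conj_phi_mul_phi (k j : Fin d → ℤ) (x : Torus d) :
    conj (phi k x) * phi j x = (normConst d : ℂ) * phi (j - k) x := by
  simp only [phi_apply, sub_eq_add_neg, expo_add, expo_neg, map_mul, Complex.conj_ofReal]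
  ring

theorem normConst_mul_integral_phi_zero : (normConst d : ℂ) * ∫ x, phi (0 : Fin d → ℤ) x = 1 := by
  simp only [phi_apply, expo_zero, mul_one, integral_const, Complex.real_smul]
  have h1 : (volume : Measure (Torus d)).real univ = (2 * Real.pi) ^ d := by
    rw [Measure.real, ← Set.pi_univ (univ : Set (Fin d)), volume_pi_pi]
    simp [AddCircle.measure_univ, ENNReal.toReal_ofReal Real.pi_pos.le]
  have h2 : normConst d * normConst d * (2 * Real.pi) ^ d = 1 := by
    rw [normConst, ← Real.rpow_add Real.two_pi_pos, ← Real.rpow_natCast,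
      ← Real.rpow_add Real.two_pi_pos]
    ring_nf
    simp
  rw [h1]
  rw [← Complex.ofReal_mul, ← Complex.ofReal_mul]
  norm_cast
  linarith

/-- Stone–Weierstrass: characters are closed under products and conjugation, so their span is a star
algebra, and the coordinate characters already separate points. -/
theorem span_expo_closure_eq_top :
    (Submodule.span ℂ (range (expo (d := d)))).topologicalClosure = ⊤ := by
  let A : StarSubalgebra ℂ C(Torus d, ℂ) :=
    { toSubalgebra := Algebra.adjoin ℂ (range expo)
      star_mem' := by
        change Algebra.adjoin ℂ (range expo) ≤ star (Algebra.adjoin ℂ (range expo))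
        refine Algebra.adjoin_le ?_
        rintro _ ⟨n, rfl⟩
        refine Algebra.subset_adjoin ⟨-n, ?_⟩
        ext1 x
        simp only [expo_neg, starRingEnd_apply, ContinuousMap.star_apply] }
  have hA : A.toSubalgebra.toSubmodule = Submodule.span ℂ (range (expo (d := d))) := by
    refine Algebra.adjoin_eq_span_of_subset _ ?_
    refine .trans (fun x ↦ Submonoid.closure_induction (fun _ ↦ id) ⟨0, ?_⟩ ?_)
      Submodule.subset_span
    · ext z
      simp [expo_zero]
    · rintro _ _ _ _ ⟨m, rfl⟩ ⟨n, rfl⟩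
      refine ⟨m + n, ?_⟩
      ext z
      simp [expo_add]
  have hsep : A.SeparatesPoints := by
    intro x y hxy
    obtain ⟨i, hi⟩ := Function.ne_iff.1 hxy
    refine ⟨_, ⟨expo (Pi.single i 1), Algebra.subset_adjoin ⟨Pi.single i 1, rfl⟩, rfl⟩, ?_⟩
    change expo (Pi.single i 1) x ≠ expo (Pi.single i 1) y
    rw [expo_single, expo_single, fourier_one, fourier_one]
    contrapose hi
    exact AddCircle.injective_toCircle Real.two_pi_pos.ne' (Circle.ext hi)
  have htop := ContinuousMap.starSubalgebra_topologicalClosure_eq_top_of_separatesPoints A hsep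
  rw [← hA]
  exact congr_arg (Subalgebra.toSubmodule <| StarSubalgebra.toSubalgebra ·) htop

/-- `φ_k` as an element of `L²(𝕋ᵈ, ℂ)`. -/
def phiLp (k : Fin d → ℤ) : Lp ℂ 2 (volume : Measure (Torus d)) :=
  ContinuousMap.toLp 2 volume ℂ (phi k)

theorem orthonormal_phiLp : Orthonormal ℂ (phiLp (d := d)) := by
  rw [orthonormal_iff_ite]
  intro k j
  rw [phiLp, phiLp, ContinuousMap.inner_toLp]
  have : ∀ x : Torus d, phi j x * conj (phi k x) = (normConst d : ℂ) * phi (j - k) x := by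
    intro x
    rw [mul_comm, conj_phi_mul_phi]
  simp only [this, integral_const_mul]
  split_ifs with h
  · rw [h, sub_self, normConst_mul_integral_phi_zero]
  · rw [integral_phi (sub_ne_zero.2 (Ne.symm h)), mul_zero]

theorem span_phiLp_closure_eq_top :
    (Submodule.span ℂ (range (phiLp (d := d)))).topologicalClosure = ⊤ := by
  have h1 : Submodule.span ℂ (range (phi (d := d))) = Submodule.span ℂ (range (expo (d := d))) := by
    have hne : (normConst d : ℂ) ≠ 0 := by exact_mod_cast (normConst_pos d).ne'
    have e : ∀ k : Fin d → ℤ, phi k = (normConst d : ℂ) • expo k := fun k => by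
      ext x
      rfl
    refine le_antisymm (Submodule.span_le.2 ?_) (Submodule.span_le.2 ?_)
    · rintro _ ⟨k, rfl⟩
      rw [e]
      exact Submodule.smul_mem _ _ (Submodule.subset_span ⟨k, rfl⟩)
    · rintro _ ⟨k, rfl⟩
      have : expo k = (normConst d : ℂ)⁻¹ • phi k := by
        rw [e, smul_smul, inv_mul_cancel₀ hne, one_smul]
      rw [this]
      exact Submodule.smul_mem _ _ (Submodule.subset_span ⟨k, rfl⟩)
  have h2 := (ContinuousMap.toLp_denseRange ℂ (volume : Measure (Torus d)) ℂ
    (p := 2) (by simp)).topologicalClosure_map_submodule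
      ((congrArg Submodule.topologicalClosure h1).trans span_expo_closure_eq_top)
  rw [Submodule.map_span, ← range_comp] at h2
  exact h2

/-- The Hilbert basis `(φ_k)` of `L²(𝕋ᵈ, ℂ)`. -/
def phiBasis (d : ℕ) : HilbertBasis (Fin d → ℤ) ℂ (Lp ℂ 2 (volume : Measure (Torus d))) :=
  HilbertBasis.mk orthonormal_phiLp span_phiLp_closure_eq_top.ge

theorem phiBasis_apply (k : Fin d → ℤ) : phiBasis d k = phiLp k := by
  rw [phiBasis, HilbertBasis.coe_mk]

/-- The square summable sequences on `ℤᵈ`. -/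
abbrev Seq (d : ℕ) : Type := lp (fun _ : Fin d → ℤ => ℂ) 2

/-- The inclusion `L²(𝕋ᵈ, ℝ) → L²(𝕋ᵈ, ℂ)`. -/
def toComplex (d : ℕ) : L2 d →L[ℝ] Lp ℂ 2 (volume : Measure (Torus d)) :=
  Complex.ofRealCLM.compLpL 2 volume

/-- The real part `L²(𝕋ᵈ, ℂ) → L²(𝕋ᵈ, ℝ)`. -/
def toReal (d : ℕ) : Lp ℂ 2 (volume : Measure (Torus d)) →L[ℝ] L2 d :=
  Complex.reCLM.compLpL 2 volume

theorem coeFn_toComplex (f : L2 d) : toComplex d f =ᵐ[volume] fun x => (f x : ℂ) :=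
  Complex.ofRealCLM.coeFn_compLpL f

theorem coeFn_toReal (g : Lp ℂ 2 (volume : Measure (Torus d))) :
    toReal d g =ᵐ[volume] fun x => (g x).re :=
  Complex.reCLM.coeFn_compLpL g

theorem norm_toComplex (f : L2 d) : ‖toComplex d f‖ = ‖f‖ := by
  refine le_antisymm (Lp.norm_le_norm_of_ae_le ?_) (Lp.norm_le_norm_of_ae_le ?_) <;>
  · filter_upwards [coeFn_toComplex f] with x hx
    simp [hx]

theorem coeFn_phiLp (k : Fin d → ℤ) : phiLp k =ᵐ[volume] phi k :=
  ContinuousMap.coeFn_toLp (p := 2) (𝕜 := ℂ) volume (phi k)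

theorem coeFn_mode (k : Fin d → ℤ) (c : ℂ) : mode k c =ᵐ[volume] fun x => (c * phi k x).re :=
  ContinuousMap.coeFn_toLp (p := 2) (𝕜 := ℝ) volume (modeFun k c)

theorem toReal_smul_phiLp (k : Fin d → ℤ) (c : ℂ) : toReal d (c • phiLp k) = mode k c := by
  refine Lp.ext ?_
  filter_upwards [coeFn_toReal (c • phiLp k), Lp.coeFn_smul c (phiLp k), coeFn_phiLp k,
    coeFn_mode k c] with x h1 h2 h3 h4
  rw [h1, h2, h4, Pi.smul_apply, h3, smul_eq_mul]

theorem phiBasis_repr (g : Lp ℂ 2 (volume : Measure (Torus d))) (k : Fin d → ℤ) :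
    (phiBasis d).repr g k = ∫ x, g x * conj (phi k x) := by
  rw [HilbertBasis.repr_apply_apply, phiBasis_apply, L2.inner_def]
  refine integral_congr_ae ?_
  filter_upwards [coeFn_phiLp k] with x hx
  rw [hx]
  simp

theorem repr_toComplex (f : L2 d) (k : Fin d → ℤ) :
    (phiBasis d).repr (toComplex d f) k = coef f k := by
  rw [phiBasis_repr, coef]
  refine integral_congr_ae ?_
  filter_upwards [coeFn_toComplex f] with x hx
  rw [hx]

/-! ### Real functions and Hermitian symmetric coefficients -/

theorem phi_neg (k : Fin d → ℤ) (x : Torus d) : phi (-k) x = conj (phi k x) := by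
  simp [phi_apply, expo_neg]

theorem coef_neg_index (f : L2 d) (k : Fin d → ℤ) : coef f (-k) = conj (coef f k) := by
  rw [coef, coef, ← integral_conj]
  refine integral_congr_ae (Eventually.of_forall fun x => ?_)
  simp [phi_neg]

theorem integrable_mul_conj_phi (g : Lp ℂ 2 (volume : Measure (Torus d))) (k : Fin d → ℤ) :
    Integrable fun x => g x * conj (phi k x) := by
  refine (L2.integrable_inner (𝕜 := ℂ) (phiLp k) g).congr ?_
  filter_upwards [coeFn_phiLp k] with x hx
  rw [hx]
  simp

theorem coef_toReal (g : Lp ℂ 2 (volume : Measure (Torus d))) (k : Fin d → ℤ) :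
    coef (toReal d g) k
      = ((phiBasis d).repr g k + conj ((phiBasis d).repr g (-k))) / 2 := by
  rw [phiBasis_repr, phiBasis_repr, coef, ← integral_conj, ← integral_add, ← integral_div]
  · refine integral_congr_ae ?_
    filter_upwards [coeFn_toReal g] with x hx
    rw [hx, phi_neg, Complex.re_eq_add_conj]
    simp
    ring
  · exact integrable_mul_conj_phi g k
  · have := (integrable_mul_conj_phi g (-k))
    exact (Complex.conjLIE.toContinuousLinearEquiv.toContinuousLinearMap).integrable_comp this

/-- The Fourier transform `L²(𝕋ᵈ, ℝ) → ℓ²(ℤᵈ)`. -/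
def fourierL2 (d : ℕ) : L2 d →ₗᵢ[ℝ] Seq d where
  toFun f := (phiBasis d).repr (toComplex d f)
  map_add' f g := by simp
  map_smul' a f := by
    refine lp.ext (funext fun k => ?_)
    rw [repr_toComplex, coef_smul, RingHom.id_apply, lp.coeFn_smul, Pi.smul_apply, repr_toComplex,
      Complex.real_smul]
  norm_map' f := by
    change ‖(phiBasis d).repr (toComplex d f)‖ = _
    rw [LinearIsometryEquiv.norm_map, norm_toComplex]

theorem fourierL2_apply (f : L2 d) (k : Fin d → ℤ) : fourierL2 d f k = coef f k :=
  repr_toComplex f k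

theorem L2_ext {f g : L2 d} (h : ∀ k, coef f k = coef g k) : f = g := by
  refine (fourierL2 d).injective (lp.ext (funext fun k => ?_))
  rw [fourierL2_apply, fourierL2_apply, h]

theorem H1_ext {u v : H1 d} (h : ∀ k, coef u.toL2 k = coef v.toL2 k) : u = v :=
  Subtype.ext (L2_ext h)

/-- Sum the series in complex `L²` and take the real part: by Hermitian symmetry this leaves the
coefficients unchanged, and it turns each term `c φ_k` into a real mode. -/
theorem exists_L2_of_even (c : Seq d) (hc : ∀ k, c (-k) = conj (c k)) :
    ∃ f : L2 d, (∀ k, coef f k = c k) ∧ HasSum (fun k => mode k (c k)) f := by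
  refine ⟨toReal d ((phiBasis d).repr.symm c), fun k => ?_, ?_⟩
  · rw [coef_toReal, LinearIsometryEquiv.apply_symm_apply, hc]
    simp
  · have h := (phiBasis d).hasSum_repr_symm c
    simp only [phiBasis_apply] at h
    have := h.mapL (toReal d)
    simpa only [toReal_smul_phiLp] using this

theorem hasSum_mode_coef (f : L2 d) : HasSum (fun k => mode k (coef f k)) f := by
  obtain ⟨g, h1, h2⟩ := exists_L2_of_even (fourierL2 d f) fun k => by
    rw [fourierL2_apply, fourierL2_apply, coef_neg_index]
  simp only [fourierL2_apply] at h1 h2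
  rwa [L2_ext h1] at h2

/-- The weight `⟨k⟩ = (1 + |k|²)^{1/2}`. -/
def bracket (k : Fin d → ℤ) : ℝ := Real.sqrt (1 + freq k ^ 2)

theorem freq_nonneg (k : Fin d → ℤ) : 0 ≤ freq k := Real.sqrt_nonneg _

theorem freq_neg (k : Fin d → ℤ) : freq (-k) = freq k := by simp [freq]

theorem bracket_neg (k : Fin d → ℤ) : bracket (-k) = bracket k := by simp [bracket, freq_neg]

theorem bracket_sq (k : Fin d → ℤ) : bracket k ^ 2 = 1 + freq k ^ 2 :=
  Real.sq_sqrt (by positivity)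

theorem one_le_bracket (k : Fin d → ℤ) : 1 ≤ bracket k :=
  Real.one_le_sqrt.2 (by nlinarith [sq_nonneg (freq k)])

theorem bracket_pos (k : Fin d → ℤ) : 0 < bracket k := one_pos.trans_le (one_le_bracket k)

theorem freq_le_bracket (k : Fin d → ℤ) : freq k ≤ bracket k :=
  Real.le_sqrt_of_sq_le (by linarith)

theorem bracket_le (k : Fin d → ℤ) : bracket k ≤ 1 + freq k :=
  Real.sqrt_le_iff.2 ⟨by linarith [freq_nonneg k], by nlinarith [freq_nonneg k]⟩

theorem hasSum_coef_sq (f : L2 d) : HasSum (fun k => ‖coef f k‖ ^ 2) (‖f‖ ^ 2) := by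
  have h := lp.hasSum_norm (p := 2) (by norm_num) (fourierL2 d f)
  simpa [fourierL2_apply] using h

theorem H1.hasSum_bracket_sq (u : H1 d) :
    HasSum (fun k => ‖(bracket k : ℂ) * coef u.toL2 k‖ ^ 2) (‖u‖ ^ 2) := by
  rw [H1.norm_sq_eq]
  have h1 : Summable fun k => freq k ^ 2 * ‖coef u.toL2 k‖ ^ 2 := u.2
  have h2 := (hasSum_coef_sq u.toL2).add h1.hasSum
  refine h2.congr_fun fun k => ?_
  rw [norm_mul, mul_pow, Complex.norm_real, Real.norm_eq_abs, sq_abs, bracket_sq]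
  ring

/-- The weighted Fourier transform `H¹(𝕋ᵈ, ℝ) → ℓ²(ℤᵈ)`, `u ↦ (⟨k⟩ ⟨u, φ_k⟩)_k`. -/
def fourierH1 (d : ℕ) : H1 d →ₗᵢ[ℝ] Seq d where
  toFun u := ⟨fun k => (bracket k : ℂ) * coef u.toL2 k, by
    refine memℓp_gen ?_
    simpa using (H1.hasSum_bracket_sq u).summable⟩
  map_add' u v := by
    refine lp.ext (funext fun k => ?_)
    change (bracket k : ℂ) * coef (H1.toL2 (u + v)) k
      = bracket k * coef (H1.toL2 u) k + bracket k * coef (H1.toL2 v) k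
    rw [map_add, coef_add, mul_add]
  map_smul' a u := by
    refine lp.ext (funext fun k => ?_)
    simp [coef_smul]
    ring
  norm_map' u := by
    set c : Seq d := ⟨fun k => (bracket k : ℂ) * coef u.toL2 k, by
      refine memℓp_gen ?_
      simpa using (H1.hasSum_bracket_sq u).summable⟩ with hc
    change ‖c‖ = ‖u‖
    have h := lp.hasSum_norm (p := 2) (by norm_num) c
    simp only [ENNReal.toReal_ofNat, Real.rpow_ofNat] at h
    exact (sq_eq_sq₀ (norm_nonneg _) (norm_nonneg _)).1 (h.unique (H1.hasSum_bracket_sq u))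

theorem fourierH1_apply (u : H1 d) (k : Fin d → ℤ) :
    fourierH1 d u k = (bracket k : ℂ) * coef u.toL2 k := rfl

/-- Dividing by the weight is an isometry from `L²` to `H¹`, through which Fourier inversion and the
realization of Hermitian sequences pass from `L²` to `H¹`. -/
theorem exists_H1_div_bracket (f : L2 d) :
    ∃ u : H1 d, ∀ k, coef u.toL2 k = coef f k / bracket k := by
  have hs : Summable fun k => ‖coef f k‖ ^ 2 := (hasSum_coef_sq f).summable
  have hle : ∀ k, ‖coef f k / bracket k‖ ≤ ‖coef f k‖ := by
    intro k
    rw [norm_div, Complex.norm_real, Real.norm_of_nonneg (bracket_pos k).le]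
    exact div_le_self (norm_nonneg _) (one_le_bracket k)
  have hmem : Memℓp (fun k => coef f k / bracket k) 2 := by
    refine memℓp_gen ?_
    simp only [ENNReal.toReal_ofNat, Real.rpow_ofNat]
    exact Summable.of_nonneg_of_le (fun k => by positivity)
      (fun k => pow_le_pow_left₀ (norm_nonneg _) (hle k) 2) hs
  obtain ⟨g, hg, -⟩ := exists_L2_of_even ⟨_, hmem⟩ fun k => by
    change coef f (-k) / bracket (-k) = conj (coef f k / bracket k)
    rw [coef_neg_index, bracket_neg, map_div₀, Complex.conj_ofReal]
  refine ⟨⟨g, ?_⟩, hg⟩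
  refine Summable.of_nonneg_of_le (fun k => by positivity) (fun k => ?_) hs
  rw [hg k]
  change freq k ^ 2 * ‖coef f k / bracket k‖ ^ 2 ≤ _
  rw [norm_div, Complex.norm_real, Real.norm_of_nonneg (bracket_pos k).le, div_pow, ← mul_div_assoc,
    div_le_iff₀ (by have := bracket_pos k; positivity), mul_comm]
  gcongr
  · exact freq_nonneg k
  · exact freq_le_bracket k

/-- The isometry `(1 - Δ)^{-1/2} : L² → H¹`. -/
def besselL2 (d : ℕ) : L2 d →ₗᵢ[ℝ] H1 d where
  toFun f := (exists_H1_div_bracket f).choose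
  map_add' f g := H1_ext fun k => by
    rw [map_add, coef_add, (exists_H1_div_bracket (f + g)).choose_spec,
      (exists_H1_div_bracket f).choose_spec, (exists_H1_div_bracket g).choose_spec, coef_add,
      add_div]
  map_smul' a f := H1_ext fun k => by
    rw [map_smul, coef_smul, (exists_H1_div_bracket (a • f)).choose_spec, RingHom.id_apply,
      (exists_H1_div_bracket f).choose_spec, coef_smul, mul_div_assoc]
  norm_map' f := by
    have : fourierH1 d (exists_H1_div_bracket f).choose = fourierL2 d f := by
      refine lp.ext (funext fun k => ?_)
      rw [fourierH1_apply, fourierL2_apply, (exists_H1_div_bracket f).choose_spec]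
      have : (bracket k : ℂ) ≠ 0 := by exact_mod_cast (bracket_pos k).ne'
      field_simp
    rw [← (fourierL2 d).norm_map f, ← this, LinearIsometry.norm_map]
    rfl

theorem coef_besselL2 (f : L2 d) (k : Fin d → ℤ) :
    coef (besselL2 d f).toL2 k = coef f k / bracket k :=
  (exists_H1_div_bracket f).choose_spec k

theorem mode_real_mul (k : Fin d → ℤ) (r : ℝ) (c : ℂ) : mode k (r * c) = r • mode k c := by
  rw [mode, mode, ← map_smul]
  congr 1
  ext x
  simp [modeFun, mul_assoc]

theorem besselL2_mode (k : Fin d → ℤ) (c : ℂ) :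
    besselL2 d (mode k c) = H1.mode k (c / bracket k) := by
  refine H1_ext fun j => ?_
  rw [coef_besselL2]
  change _ = coef (mode k (c / bracket k)) j
  have e : c / bracket k = ((bracket k)⁻¹ : ℝ) * c := by
    push_cast
    rw [div_eq_inv_mul]
  by_cases hj : j = k ∨ j = -k
  · have : bracket j = bracket k := by
      rcases hj with rfl | rfl
      · rfl
      · exact bracket_neg k
    rw [e, mode_real_mul, coef_smul, this, div_eq_inv_mul]
    push_cast
    rfl
  · rw [not_or] at hj
    rw [coef_mode_eq_zero k j c hj.1 hj.2, coef_mode_eq_zero k j _ hj.1 hj.2, zero_div]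

theorem exists_H1_of_even (c : Seq d) (hc : ∀ k, c (-k) = conj (c k)) :
    ∃ u : H1 d, (∀ k, coef u.toL2 k = c k / bracket k) ∧
      HasSum (fun k => H1.mode k (c k / bracket k)) u := by
  obtain ⟨f, h1, h2⟩ := exists_L2_of_even c hc
  refine ⟨besselL2 d f, fun k => by rw [coef_besselL2, h1], ?_⟩
  have := h2.mapL (besselL2 d).toContinuousLinearMap
  simpa only [LinearIsometry.coe_toContinuousLinearMap, besselL2_mode] using this

/-! ### Fourier multipliers -/

/-- An isometry onto the Hermitian symmetric sequences in `ℓ²(ℤᵈ)`. -/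
structure IsFourierRep {E : Type*} [NormedAddCommGroup E] [NormedSpace ℝ E]
    (F : E →ₗᵢ[ℝ] Seq d) : Prop where
  even : ∀ x k, F x (-k) = conj (F x k)
  surj : ∀ c : Seq d, (∀ k, c (-k) = conj (c k)) → ∃ x, F x = c

theorem isFourierRep_L2 : IsFourierRep (fourierL2 d) where
  even f k := by rw [fourierL2_apply, fourierL2_apply, coef_neg_index]
  surj c hc := by
    obtain ⟨f, hf, -⟩ := exists_L2_of_even c hc
    exact ⟨f, lp.ext (funext fun k => by rw [fourierL2_apply, hf])⟩

theorem bracket_ne_zero (k : Fin d → ℤ) : (bracket k : ℂ) ≠ 0 := by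
  exact_mod_cast (bracket_pos k).ne'

theorem isFourierRep_H1 : IsFourierRep (fourierH1 d) where
  even u k := by
    rw [fourierH1_apply, fourierH1_apply, coef_neg_index, bracket_neg, map_mul, Complex.conj_ofReal]
  surj c hc := by
    obtain ⟨u, hu, -⟩ := exists_H1_of_even c hc
    refine ⟨u, lp.ext (funext fun k => ?_)⟩
    rw [fourierH1_apply, hu, mul_div_cancel₀ _ (bracket_ne_zero k)]

section Multiplier

variable {E E' : Type*} [NormedAddCommGroup E] [NormedSpace ℝ E] [NormedAddCommGroup E']
  [NormedSpace ℝ E'] {F : E →ₗᵢ[ℝ] Seq d} {G : E' →ₗᵢ[ℝ] Seq d}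

theorem norm_le_of_multiplier {x : E} {y : E'} {M : ℝ} (hM : 0 ≤ M)
    (h : ∀ k, ‖G y k‖ ≤ M * ‖F x k‖) : ‖y‖ ≤ M * ‖x‖ := by
  rw [← G.norm_map, ← F.norm_map]
  have h1 : ‖G y‖ ≤ ‖M • F x‖ := lp.norm_mono (by norm_num) fun k => by
    refine (h k).trans (le_of_eq ?_)
    rw [lp.coeFn_smul, Pi.smul_apply, norm_smul, Real.norm_of_nonneg hM]
  rwa [norm_smul, Real.norm_of_nonneg hM] at h1

/-- A real even symbol preserves Hermitian symmetry, so the multiplied sequence is again the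
transform of a real function. Working with abstract representations `F` and `G` covers all maps
between `L²` and `H¹`. -/
theorem exists_multiplier (hF : IsFourierRep F) (hG : IsFourierRep G) (m : (Fin d → ℤ) → ℝ) {M : ℝ}
    (hm : ∀ k, |m k| ≤ M) (he : ∀ k, m (-k) = m k) :
    ∃ T : E →L[ℝ] E', ∀ x k, G (T x) k = m k * F x k := by
  have hM : 0 ≤ M := (abs_nonneg _).trans (hm 0)
  have hb : ∀ (x : E) k, ‖(m k : ℂ) * F x k‖ ≤ M * ‖F x k‖ := by
    intro x k
    rw [norm_mul, Complex.norm_real, Real.norm_eq_abs]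
    gcongr
    exact hm k
  have hex : ∀ x : E, ∃ y : E', ∀ k, G y k = m k * F x k := by
    intro x
    have hmem : Memℓp (fun k => (m k : ℂ) * F x k) 2 := by
      refine memℓp_gen ?_
      have hs := (lp.hasSum_norm (p := 2) (by norm_num) (F x)).summable
      simp only [ENNReal.toReal_ofNat, Real.rpow_ofNat] at hs ⊢
      refine Summable.of_nonneg_of_le (fun k => by positivity) (fun k => ?_) (hs.mul_left (M ^ 2))
      rw [← mul_pow]
      exact pow_le_pow_left₀ (norm_nonneg _) (hb x k) 2
    obtain ⟨y, hy⟩ := hG.surj ⟨_, hmem⟩ fun k => by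
      change (m (-k) : ℂ) * F x (-k) = conj ((m k : ℂ) * F x k)
      rw [he, hF.even, map_mul, Complex.conj_ofReal]
    exact ⟨y, fun k => by rw [hy]⟩
  choose T hT using hex
  refine ⟨LinearMap.mkContinuous ⟨⟨T, fun x y => ?_⟩, fun a x => ?_⟩ M fun x => ?_, hT⟩
  · refine G.injective (lp.ext (funext fun k => ?_))
    rw [map_add, lp.coeFn_add, Pi.add_apply, hT, hT, hT, map_add, lp.coeFn_add, Pi.add_apply,
      mul_add]
  · refine G.injective (lp.ext (funext fun k => ?_))
    simp only [RingHom.id_apply, map_smul, lp.coeFn_smul, Pi.smul_apply, hT, Complex.real_smul]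
    ring
  · refine norm_le_of_multiplier (F := F) (G := G) hM fun k => ?_
    exact (congrArg norm (hT x k)).trans_le (hb x k)

/-- Dominated convergence in Parseval's sum. It supplies strong continuity and the short time limits
below, where convergence of the symbol is only pointwise in `k`. -/
theorem tendsto_zero_of_multiplier {ι : Type*} {l : Filter ι} {x : E} {y : ι → E'}
    {m : ι → (Fin d → ℤ) → ℝ} {M : ℝ} (h : ∀ᶠ t in l, ∀ k, G (y t) k = m t k * F x k)
    (hm : ∀ᶠ t in l, ∀ k, |m t k| ≤ M) (h0 : ∀ k, Tendsto (fun t => m t k) l (𝓝 0)) :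
    Tendsto y l (𝓝 0) := by
  have hs := (lp.hasSum_norm (p := 2) (by norm_num) (F x)).summable
  simp only [ENNReal.toReal_ofNat, Real.rpow_ofNat] at hs
  have key : Tendsto (fun t => ∑' k, |m t k| ^ 2 * ‖F x k‖ ^ 2) l
      (𝓝 (∑' _ : Fin d → ℤ, (0 : ℝ))) := by
    refine tendsto_tsum_of_dominated_convergence (bound := fun k => M ^ 2 * ‖F x k‖ ^ 2)
      (hs.mul_left _) (fun k => ?_) ?_
    · have := ((h0 k).abs.pow 2).mul_const (‖F x k‖ ^ 2)
      simpa using this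
    · filter_upwards [hm] with t ht k
      rw [Real.norm_of_nonneg (by positivity)]
      gcongr
      exact ht k
  rw [tsum_zero] at key
  have hsq : Tendsto (fun t => ‖y t‖ ^ 2) l (𝓝 0) := by
    refine key.congr' ?_
    filter_upwards [h] with t ht
    have h2 := (lp.hasSum_norm (p := 2) (by norm_num) (G (y t))).tsum_eq
    simp only [ENNReal.toReal_ofNat, Real.rpow_ofNat, LinearIsometry.norm_map] at h2
    rw [← h2]
    refine tsum_congr fun k => ?_
    rw [ht k, norm_mul, Complex.norm_real, Real.norm_eq_abs, mul_pow]
  rw [tendsto_zero_iff_norm_tendsto_zero]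
  have := hsq.sqrt
  simpa using this

end Multiplier

theorem H1.hasSum_mode_coef (u : H1 d) : HasSum (fun k => H1.mode k (coef u.toL2 k)) u := by
  obtain ⟨v, h1, h2⟩ := exists_H1_of_even (fourierH1 d u) (isFourierRep_H1.even u)
  simp only [fourierH1_apply, mul_div_cancel_left₀ _ (bracket_ne_zero _)] at h1 h2
  rwa [H1_ext h1] at h2

theorem freq_eq_zero {k : Fin d → ℤ} : freq k = 0 ↔ k = 0 := by
  rw [freq, Real.sqrt_eq_zero (by positivity), Finset.sum_eq_zero_iff_of_nonneg (by intros; positivity)]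
  simp [funext_iff]

theorem freq_mul_sinDiv (k : Fin d → ℤ) (t : ℝ) : freq k * sinDiv k t = Real.sin (freq k * t) := by
  rw [sinDiv]
  split_ifs with h
  · simp [freq_eq_zero.2 h]
  · rw [mul_div_cancel₀ _ (mt freq_eq_zero.1 h)]

theorem sinDiv_neg_index (k : Fin d → ℤ) (t : ℝ) : sinDiv (-k) t = sinDiv k t := by
  simp [sinDiv, freq_neg]

theorem sinDiv_zero (k : Fin d → ℤ) : sinDiv k 0 = 0 := by
  simp [sinDiv]

theorem continuous_sinDiv (k : Fin d → ℤ) : Continuous (sinDiv k) := by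
  unfold sinDiv
  split_ifs
  · exact continuous_id
  · fun_prop

theorem sinDiv_add (k : Fin d → ℤ) (s t : ℝ) :
    sinDiv k (s + t) = Real.cos (freq k * s) * sinDiv k t + sinDiv k s * Real.cos (freq k * t) := by
  simp only [sinDiv]
  split_ifs with h
  · simp [freq_eq_zero.2 h]
    ring
  · rw [mul_add, Real.sin_add]
    ring

theorem abs_sinDiv_le (k : Fin d → ℤ) (t : ℝ) : |sinDiv k t| ≤ |t| := by
  rw [sinDiv]
  split_ifs with h
  · exact le_rfl
  · have hf : 0 < freq k := (freq_nonneg k).lt_of_ne' (mt freq_eq_zero.1 h)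
    rw [abs_div, abs_of_pos hf, div_le_iff₀ hf]
    refine Real.abs_sin_le_abs.trans (le_of_eq ?_)
    rw [abs_mul, abs_of_pos hf, mul_comm]

/-- The sine propagator gains one derivative: `|k|` times the symbol is a sine, and the low
frequencies cost at most `|t|`. Hence it is bounded from `L²` to `H¹`. -/
theorem bracket_mul_abs_sinDiv_le (k : Fin d → ℤ) (t : ℝ) : bracket k * |sinDiv k t| ≤ 1 + |t| := by
  have h1 : freq k * |sinDiv k t| ≤ 1 := by
    rw [← abs_of_nonneg (freq_nonneg k), ← abs_mul, freq_mul_sinDiv]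
    exact Real.abs_sin_le_one _
  calc bracket k * |sinDiv k t| ≤ (1 + freq k) * |sinDiv k t| := by gcongr; exact bracket_le k
    _ ≤ 1 + |t| := by linarith [abs_sinDiv_le k t]

/-! ### The free evolution -/

theorem exists_cosL2 (t : ℝ) : ∃ T : L2 d →L[ℝ] L2 d, ∀ v k,
    fourierL2 d (T v) k = (Real.cos (freq k * t) : ℝ) * fourierL2 d v k :=
  exists_multiplier isFourierRep_L2 isFourierRep_L2 _ (fun _ => Real.abs_cos_le_one _)
    fun k => by rw [freq_neg]

theorem exists_cosH1 (t : ℝ) : ∃ T : H1 d →L[ℝ] H1 d, ∀ v k,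
    fourierH1 d (T v) k = (Real.cos (freq k * t) : ℝ) * fourierH1 d v k :=
  exists_multiplier isFourierRep_H1 isFourierRep_H1 _ (fun _ => Real.abs_cos_le_one _)
    fun k => by rw [freq_neg]

theorem exists_sinOp (t : ℝ) : ∃ T : L2 d →L[ℝ] H1 d, ∀ v k,
    fourierH1 d (T v) k = (bracket k * sinDiv k t : ℝ) * fourierL2 d v k :=
  exists_multiplier isFourierRep_L2 isFourierRep_H1 _ (M := 1 + |t|)
    (fun k => by
      rw [abs_mul, abs_of_pos (bracket_pos k)]
      exact bracket_mul_abs_sinDiv_le k t)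
    fun k => by rw [bracket_neg, sinDiv_neg_index]

theorem abs_freq_mul_sin_div_le (k : Fin d → ℤ) (t : ℝ) :
    |-(freq k * Real.sin (freq k * t) / bracket k)| ≤ 1 := by
  rw [abs_neg, abs_div, abs_mul, abs_of_pos (bracket_pos k), abs_of_nonneg (freq_nonneg k),
    div_le_one (bracket_pos k)]
  have h1 := Real.abs_sin_le_one (freq k * t)
  nlinarith [freq_nonneg k, freq_le_bracket k]

theorem exists_dcosOp (t : ℝ) : ∃ T : H1 d →L[ℝ] L2 d, ∀ v k,
    fourierL2 d (T v) k = (-(freq k * Real.sin (freq k * t) / bracket k) : ℝ) * fourierH1 d v k :=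
  exists_multiplier isFourierRep_H1 isFourierRep_L2 _ (M := 1)
    (fun k => abs_freq_mul_sin_div_le k t)
    fun k => by rw [bracket_neg, freq_neg]

/-- `cos(t√(-Δ))` on `L²`. -/
def cosL2 (d : ℕ) (t : ℝ) : L2 d →L[ℝ] L2 d := (exists_cosL2 t).choose

/-- `cos(t√(-Δ))` on `H¹`. -/
def cosH1 (d : ℕ) (t : ℝ) : H1 d →L[ℝ] H1 d := (exists_cosH1 t).choose

/-- `sin(t√(-Δ)) / √(-Δ)` from `L²` to `H¹`. -/
def sinOp (d : ℕ) (t : ℝ) : L2 d →L[ℝ] H1 d := (exists_sinOp t).choose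

/-- `-√(-Δ) sin(t√(-Δ))` from `H¹` to `L²`. -/
def dcosOp (d : ℕ) (t : ℝ) : H1 d →L[ℝ] L2 d := (exists_dcosOp t).choose

theorem coef_cosL2 (t : ℝ) (v : L2 d) (k : Fin d → ℤ) :
    coef (cosL2 d t v) k = (Real.cos (freq k * t) : ℝ) * coef v k := by
  have h : fourierL2 d (cosL2 d t v) k = _ := (exists_cosL2 t).choose_spec v k
  simpa only [fourierL2_apply] using h

theorem coef_cosH1 (t : ℝ) (w : H1 d) (k : Fin d → ℤ) :
    coef (cosH1 d t w).toL2 k = (Real.cos (freq k * t) : ℝ) * coef w.toL2 k := by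
  have h : fourierH1 d (cosH1 d t w) k = _ := (exists_cosH1 t).choose_spec w k
  simp only [fourierH1_apply, mul_left_comm _ (bracket k : ℂ)] at h
  exact mul_left_cancel₀ (bracket_ne_zero k) h

theorem coef_sinOp (t : ℝ) (v : L2 d) (k : Fin d → ℤ) :
    coef (sinOp d t v).toL2 k = (sinDiv k t : ℝ) * coef v k := by
  have h : fourierH1 d (sinOp d t v) k = _ := (exists_sinOp t).choose_spec v k
  simp only [fourierH1_apply, fourierL2_apply, Complex.ofReal_mul, mul_assoc] at h
  exact mul_left_cancel₀ (bracket_ne_zero k) h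

theorem coef_dcosOp (t : ℝ) (w : H1 d) (k : Fin d → ℤ) :
    coef (dcosOp d t w) k = (-(freq k * Real.sin (freq k * t)) : ℝ) * coef w.toL2 k := by
  have h : fourierL2 d (dcosOp d t w) k = _ := (exists_dcosOp t).choose_spec w k
  rw [fourierH1_apply, fourierL2_apply] at h
  refine h.trans ?_
  have := bracket_ne_zero k
  push_cast
  field_simp

/-- The free evolution `e^{t𝒜}` as a bounded operator. -/
def waveGroup (d : ℕ) (t : ℝ) : State d →L[ℝ] State d :=
  ((cosH1 d t).comp (ContinuousLinearMap.fst ℝ _ _)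
    + (sinOp d t).comp (ContinuousLinearMap.snd ℝ _ _)).prod
  ((dcosOp d t).comp (ContinuousLinearMap.fst ℝ _ _)
    + (cosL2 d t).comp (ContinuousLinearMap.snd ℝ _ _))

theorem waveGroup_apply (t : ℝ) (W : State d) :
    waveGroup d t W = (cosH1 d t W.1 + sinOp d t W.2, dcosOp d t W.1 + cosL2 d t W.2) := rfl

/-- Both components are Fourier inversion for the image under the bounded multipliers; this also
shows that the defining series converge. -/
theorem freeEvolution_eq (t : ℝ) (W : State d) : freeEvolution t W = waveGroup d t W := by
  rw [waveGroup_apply, freeEvolution]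
  refine Prod.ext ?_ ?_
  · refine ((H1.hasSum_mode_coef (cosH1 d t W.1 + sinOp d t W.2)).congr_fun fun k => ?_).tsum_eq
    rw [map_add, coef_add, coef_cosH1, coef_sinOp, mul_comm _ (coef W.2 k),
      mul_comm _ (coef W.1.toL2 k)]
  · refine ((hasSum_mode_coef (dcosOp d t W.1 + cosL2 d t W.2)).congr_fun fun k => ?_).tsum_eq
    rw [coef_add, coef_dcosOp, coef_cosL2]
    push_cast
    congr 1
    ring

theorem waveGroup_zero : waveGroup d 0 = 1 := by
  refine ContinuousLinearMap.ext fun W => ?_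
  rw [waveGroup_apply]
  refine Prod.ext (H1_ext fun k => ?_) (L2_ext fun k => ?_)
  · simp [coef_add, coef_cosH1, coef_sinOp, sinDiv_zero]
  · simp [coef_add, coef_dcosOp, coef_cosL2]

theorem waveGroup_add (s t : ℝ) (W : State d) :
    waveGroup d (s + t) W = waveGroup d s (waveGroup d t W) := by
  simp only [waveGroup_apply]
  refine Prod.ext (H1_ext fun k => ?_) (L2_ext fun k => ?_)
  · simp only [map_add, coef_add, coef_cosH1, coef_sinOp, coef_dcosOp, coef_cosL2, sinDiv_add,
      mul_add, Real.cos_add, ← freq_mul_sinDiv]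
    push_cast
    ring
  · simp only [map_add, coef_add, coef_cosH1, coef_sinOp, coef_dcosOp, coef_cosL2,
      mul_add, Real.cos_add, Real.sin_add, ← freq_mul_sinDiv]
    push_cast
    ring

theorem norm_cosL2_le (t : ℝ) (v : L2 d) : ‖cosL2 d t v‖ ≤ ‖v‖ := by
  have := norm_le_of_multiplier (F := fourierL2 d) (G := fourierL2 d) (x := v) (y := cosL2 d t v)
    zero_le_one fun k => by
      rw [fourierL2_apply, fourierL2_apply, coef_cosL2, norm_mul, Complex.norm_real]
      gcongr
      exact Real.abs_cos_le_one _
  rwa [one_mul] at this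

theorem norm_cosH1_le (t : ℝ) (w : H1 d) : ‖cosH1 d t w‖ ≤ ‖w‖ := by
  have := norm_le_of_multiplier (F := fourierH1 d) (G := fourierH1 d) (x := w) (y := cosH1 d t w)
    zero_le_one fun k => by
      rw [fourierH1_apply, fourierH1_apply, coef_cosH1, mul_left_comm, norm_mul, Complex.norm_real]
      gcongr
      exact Real.abs_cos_le_one _
  rwa [one_mul] at this

theorem norm_sinOp_le (t : ℝ) (v : L2 d) : ‖sinOp d t v‖ ≤ (1 + |t|) * ‖v‖ := by
  refine norm_le_of_multiplier (F := fourierL2 d) (G := fourierH1 d) (by positivity) fun k => ?_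
  rw [fourierL2_apply, fourierH1_apply, coef_sinOp, ← mul_assoc, norm_mul, norm_mul,
    Complex.norm_real, Complex.norm_real, Real.norm_of_nonneg (bracket_pos k).le]
  gcongr
  exact bracket_mul_abs_sinDiv_le k t

theorem norm_dcosOp_le (t : ℝ) (w : H1 d) : ‖dcosOp d t w‖ ≤ ‖w‖ := by
  have := norm_le_of_multiplier (F := fourierH1 d) (G := fourierL2 d) (x := w) (y := dcosOp d t w)
    zero_le_one fun k => by
      rw [show fourierL2 d (dcosOp d t w) k = _ from (exists_dcosOp t).choose_spec w k, norm_mul,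
        Complex.norm_real]
      gcongr
      exact abs_freq_mul_sin_div_le k t
  rwa [one_mul] at this

theorem norm_waveGroup_le (t : ℝ) : ‖waveGroup d t‖ ≤ 2 + |t| := by
  refine ContinuousLinearMap.opNorm_le_bound _ (by positivity) fun W => ?_
  rw [waveGroup_apply]
  have h1 := norm_fst_le W
  have h2 := norm_snd_le W
  have ht := abs_nonneg t
  refine max_le ?_ ?_
  · refine (norm_add_le _ _).trans ?_
    have := norm_cosH1_le t W.1
    have := norm_sinOp_le t W.2
    nlinarith
  · refine (norm_add_le _ _).trans ?_
    have := norm_dcosOp_le t W.1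
    have := norm_cosL2_le t W.2
    nlinarith [norm_nonneg W]

theorem continuous_cosL2 (v : L2 d) : Continuous fun t => cosL2 d t v := by
  rw [continuous_iff_continuousAt]
  intro t₀
  rw [ContinuousAt, ← tendsto_sub_nhds_zero_iff]
  refine tendsto_zero_of_multiplier (F := fourierL2 d) (G := fourierL2 d) (x := v) (M := 2)
    (m := fun t k => Real.cos (freq k * t) - Real.cos (freq k * t₀))
    (Eventually.of_forall fun t k => ?_) (Eventually.of_forall fun t k => ?_) fun k => ?_
  · simp only [map_sub, lp.coeFn_sub, Pi.sub_apply, fourierL2_apply, coef_cosL2]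
    push_cast
    ring
  · have h1 := Real.abs_cos_le_one (freq k * t)
    have h2 := Real.abs_cos_le_one (freq k * t₀)
    exact (abs_sub _ _).trans (by linarith)
  · rw [tendsto_sub_nhds_zero_iff]
    exact Continuous.tendsto (by fun_prop) _

theorem continuous_cosH1 (w : H1 d) : Continuous fun t => cosH1 d t w := by
  rw [continuous_iff_continuousAt]
  intro t₀
  rw [ContinuousAt, ← tendsto_sub_nhds_zero_iff]
  refine tendsto_zero_of_multiplier (F := fourierH1 d) (G := fourierH1 d) (x := w) (M := 2)
    (m := fun t k => Real.cos (freq k * t) - Real.cos (freq k * t₀))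
    (Eventually.of_forall fun t k => ?_) (Eventually.of_forall fun t k => ?_) fun k => ?_
  · simp only [map_sub, lp.coeFn_sub, Pi.sub_apply, fourierH1_apply, coef_cosH1]
    push_cast
    ring
  · have h1 := Real.abs_cos_le_one (freq k * t)
    have h2 := Real.abs_cos_le_one (freq k * t₀)
    exact (abs_sub _ _).trans (by linarith)
  · rw [tendsto_sub_nhds_zero_iff]
    exact Continuous.tendsto (by fun_prop) _

theorem continuous_sinOp (v : L2 d) : Continuous fun t => sinOp d t v := by
  rw [continuous_iff_continuousAt]
  intro t₀
  rw [ContinuousAt, ← tendsto_sub_nhds_zero_iff]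
  have hb : ∀ᶠ t in 𝓝 t₀, |t| < |t₀| + 1 :=
    (continuous_abs.tendsto t₀).eventually (gt_mem_nhds (by linarith))
  refine tendsto_zero_of_multiplier (F := fourierL2 d) (G := fourierH1 d) (x := v)
    (M := (1 + (|t₀| + 1)) + (1 + |t₀|))
    (m := fun t k => bracket k * sinDiv k t - bracket k * sinDiv k t₀)
    (Eventually.of_forall fun t k => ?_) (hb.mono fun t ht k => ?_) fun k => ?_
  · simp only [map_sub, lp.coeFn_sub, Pi.sub_apply, fourierH1_apply, fourierL2_apply, coef_sinOp]
    push_cast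
    ring
  · have h1 := bracket_mul_abs_sinDiv_le k t
    have h2 := bracket_mul_abs_sinDiv_le k t₀
    refine (abs_sub _ _).trans ?_
    rw [abs_mul, abs_mul, abs_of_pos (bracket_pos k)]
    linarith
  · rw [tendsto_sub_nhds_zero_iff]
    exact ((continuous_sinDiv k).const_mul _).tendsto _

theorem continuous_dcosOp (w : H1 d) : Continuous fun t => dcosOp d t w := by
  rw [continuous_iff_continuousAt]
  intro t₀
  rw [ContinuousAt, ← tendsto_sub_nhds_zero_iff]
  refine tendsto_zero_of_multiplier (F := fourierH1 d) (G := fourierL2 d) (x := w) (M := 2)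
    (m := fun t k => -(freq k * Real.sin (freq k * t) / bracket k)
      - -(freq k * Real.sin (freq k * t₀) / bracket k))
    (Eventually.of_forall fun t k => ?_) (Eventually.of_forall fun t k => ?_) fun k => ?_
  · simp only [map_sub, lp.coeFn_sub, Pi.sub_apply, fourierH1_apply, fourierL2_apply, coef_dcosOp]
    have := bracket_ne_zero k
    push_cast
    field_simp
  · have h1 := abs_freq_mul_sin_div_le k t
    have h2 := abs_freq_mul_sin_div_le k t₀
    exact (abs_sub _ _).trans (by linarith)
  · rw [tendsto_sub_nhds_zero_iff]
    exact Continuous.tendsto (by fun_prop) _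

theorem isOperatorGroup_waveGroup : IsOperatorGroup (waveGroup d) where
  zero := waveGroup_zero
  add := waveGroup_add
  cont W := ((continuous_cosH1 W.1).add (continuous_sinOp W.2)).prodMk
    ((continuous_dcosOp W.1).add (continuous_cosL2 W.2))
  bdd R := ⟨2 + |R|, by positivity, fun t ht =>
    (norm_waveGroup_le t).trans (by linarith [le_abs_self R])⟩

/-! ### Short time asymptotics of the free evolution -/

theorem toL2_cosH1 (t : ℝ) (w : H1 d) : (cosH1 d t w).toL2 = cosL2 d t w.toL2 :=
  L2_ext fun k => by rw [coef_cosH1, coef_cosL2]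

theorem norm_sinOp_toL2_le (t : ℝ) (g : H1 d) : ‖sinOp d t g.toL2‖ ≤ |t| * ‖g‖ := by
  refine norm_le_of_multiplier (F := fourierH1 d) (G := fourierH1 d) (abs_nonneg t) fun k => ?_
  rw [fourierH1_apply, fourierH1_apply, coef_sinOp, mul_left_comm, norm_mul, Complex.norm_real]
  gcongr
  exact abs_sinDiv_le k t

theorem norm_toL2_sinOp_le (t : ℝ) (v : L2 d) : ‖(sinOp d t v).toL2‖ ≤ |t| * ‖v‖ := by
  refine norm_le_of_multiplier (F := fourierL2 d) (G := fourierL2 d) (abs_nonneg t) fun k => ?_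
  rw [fourierL2_apply, fourierL2_apply, coef_sinOp, norm_mul, Complex.norm_real]
  gcongr
  exact abs_sinDiv_le k t

/-- One derivative of regularity buys a factor `|t|`. At time `s²` this beats the amplitude `s⁻¹` of
the conjugating kicks. -/
theorem norm_cosL2_sub_le (t : ℝ) (g : H1 d) : ‖cosL2 d t g.toL2 - g.toL2‖ ≤ |t| * ‖g‖ := by
  refine norm_le_of_multiplier (F := fourierH1 d) (G := fourierL2 d) (abs_nonneg t) fun k => ?_
  have h1 : |Real.cos (freq k * t) - 1| ≤ |t| * bracket k := by
    have := Real.abs_cos_sub_cos_le (freq k * t) 0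
    rw [Real.cos_zero, sub_zero, abs_mul, abs_of_nonneg (freq_nonneg k)] at this
    nlinarith [freq_le_bracket k, abs_nonneg t]
  have e : fourierL2 d (cosL2 d t g.toL2 - g.toL2) k
      = ((Real.cos (freq k * t) - 1 : ℝ) : ℂ) * coef g.toL2 k := by
    simp only [map_sub, lp.coeFn_sub, Pi.sub_apply, fourierL2_apply, coef_cosL2]
    push_cast
    ring
  rw [e, fourierH1_apply, norm_mul, norm_mul, Complex.norm_real, Complex.norm_real,
    Real.norm_of_nonneg (bracket_pos k).le, ← mul_assoc]
  gcongr
  exact h1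

theorem tendsto_sinDiv_div (k : Fin d → ℤ) :
    Tendsto (fun t => t⁻¹ * sinDiv k t) (𝓝[≠] 0) (𝓝 1) := by
  by_cases h : k = 0
  · refine tendsto_const_nhds.congr' ?_
    filter_upwards [self_mem_nhdsWithin] with t ht
    rw [sinDiv, if_pos h, inv_mul_cancel₀ ht]
  · have hf := mt freq_eq_zero.1 h
    have h1 : HasDerivAt (fun t => Real.sin (freq k * t) / freq k) 1 0 := by
      have := (((hasDerivAt_id (0:ℝ)).const_mul (freq k)).sin).div_const (freq k)
      simpa [hf] using this
    have h2 := h1.tendsto_slope_zero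
    simpa [sinDiv, h] using h2

/-- The mechanism that moves the profile: an initial velocity `t⁻¹ g` shifts it by approximately `g`
in time `t`. -/
theorem tendsto_inv_smul_sinOp_H1 (g : H1 d) :
    Tendsto (fun t : ℝ => t⁻¹ • sinOp d t g.toL2) (𝓝[≠] 0) (𝓝 g) := by
  rw [← tendsto_sub_nhds_zero_iff]
  refine tendsto_zero_of_multiplier (F := fourierH1 d) (G := fourierH1 d) (x := g) (M := 2)
    (m := fun t k => t⁻¹ * sinDiv k t - 1)
    (Eventually.of_forall fun t k => ?_) ?_ fun k => ?_
  · simp only [map_sub, map_smul, lp.coeFn_sub, Pi.sub_apply, lp.coeFn_smul, Pi.smul_apply,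
      fourierH1_apply, coef_sinOp, Complex.real_smul]
    push_cast
    ring
  · filter_upwards [self_mem_nhdsWithin] with t ht k
    refine (abs_sub _ _).trans ?_
    rw [abs_mul, abs_inv, abs_one]
    have : |t|⁻¹ * |sinDiv k t| ≤ 1 := by
      rw [inv_mul_le_iff₀ (abs_pos.2 ht), mul_one]
      exact abs_sinDiv_le k t
    linarith
  · rw [tendsto_sub_nhds_zero_iff]
    exact tendsto_sinDiv_div k

theorem tendsto_inv_smul_toL2_sinOp (v : L2 d) :
    Tendsto (fun t : ℝ => t⁻¹ • (sinOp d t v).toL2) (𝓝[≠] 0) (𝓝 v) := by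
  rw [← tendsto_sub_nhds_zero_iff]
  refine tendsto_zero_of_multiplier (F := fourierL2 d) (G := fourierL2 d) (x := v) (M := 2)
    (m := fun t k => t⁻¹ * sinDiv k t - 1)
    (Eventually.of_forall fun t k => ?_) ?_ fun k => ?_
  · simp only [map_sub, map_smul, lp.coeFn_sub, Pi.sub_apply, lp.coeFn_smul, Pi.smul_apply,
      fourierL2_apply, coef_sinOp, Complex.real_smul]
    push_cast
    ring
  · filter_upwards [self_mem_nhdsWithin] with t ht k
    refine (abs_sub _ _).trans ?_
    rw [abs_mul, abs_inv, abs_one]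
    have : |t|⁻¹ * |sinDiv k t| ≤ 1 := by
      rw [inv_mul_le_iff₀ (abs_pos.2 ht), mul_one]
      exact abs_sinDiv_le k t
    linarith
  · rw [tendsto_sub_nhds_zero_iff]
    exact tendsto_sinDiv_div k

/-! ### Multiplication operators -/

theorem coeFn_mulL2 (m : C(Torus d, ℝ)) (f : L2 d) :
    mulL2 m f =ᵐ[volume] fun x => m x * f x := by
  filter_upwards [Lp.coeFn_lpSMul (r := 2) (ContinuousMap.toLp ∞ volume ℝ m :
    Lp ℝ ∞ (volume : Measure (Torus d))) f,
    ContinuousMap.coeFn_toLp (p := ∞) (𝕜 := ℝ) volume m] with x h1 h2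
  rw [mulL2, h1, Pi.smul_apply', h2, smul_eq_mul]

theorem mulL2_add (m : C(Torus d, ℝ)) (f g : L2 d) : mulL2 m (f + g) = mulL2 m f + mulL2 m g := by
  refine Lp.ext ?_
  filter_upwards [coeFn_mulL2 m (f + g), coeFn_mulL2 m f, coeFn_mulL2 m g, Lp.coeFn_add f g,
    Lp.coeFn_add (mulL2 m f) (mulL2 m g)] with x h1 h2 h3 h4 h5
  rw [h1, h5, Pi.add_apply, h2, h3, h4, Pi.add_apply, mul_add]

theorem mulL2_smul (m : C(Torus d, ℝ)) (a : ℝ) (f : L2 d) : mulL2 m (a • f) = a • mulL2 m f := by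
  refine Lp.ext ?_
  filter_upwards [coeFn_mulL2 m (a • f), coeFn_mulL2 m f, Lp.coeFn_smul a f,
    Lp.coeFn_smul a (mulL2 m f)] with x h1 h2 h3 h4
  rw [h1, h4, Pi.smul_apply, h2, h3, Pi.smul_apply, smul_eq_mul, smul_eq_mul]
  ring

theorem norm_mulL2_le (m : C(Torus d, ℝ)) (f : L2 d) : ‖mulL2 m f‖ ≤ ‖m‖ * ‖f‖ := by
  refine Lp.norm_le_mul_norm_of_ae_le_mul ?_
  filter_upwards [coeFn_mulL2 m f] with x h1
  rw [h1, norm_mul]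
  gcongr
  exact m.norm_coe_le_norm x

theorem add_mulL2 (m n : C(Torus d, ℝ)) (f : L2 d) : mulL2 (m + n) f = mulL2 m f + mulL2 n f := by
  refine Lp.ext ?_
  filter_upwards [coeFn_mulL2 (m + n) f, coeFn_mulL2 m f, coeFn_mulL2 n f,
    Lp.coeFn_add (mulL2 m f) (mulL2 n f)] with x h1 h2 h3 h5
  rw [h1, h5, Pi.add_apply, h2, h3, ContinuousMap.add_apply, add_mul]

theorem smul_mulL2 (a : ℝ) (m : C(Torus d, ℝ)) (f : L2 d) : mulL2 (a • m) f = a • mulL2 m f := by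
  refine Lp.ext ?_
  filter_upwards [coeFn_mulL2 (a • m) f, coeFn_mulL2 m f, Lp.coeFn_smul a (mulL2 m f)]
    with x h1 h2 h4
  rw [h1, h4, Pi.smul_apply, h2, ContinuousMap.smul_apply, smul_eq_mul, smul_eq_mul, mul_assoc]

theorem mul_mulL2 (m n : C(Torus d, ℝ)) (f : L2 d) : mulL2 (m * n) f = mulL2 m (mulL2 n f) := by
  refine Lp.ext ?_
  filter_upwards [coeFn_mulL2 (m * n) f, coeFn_mulL2 m (mulL2 n f), coeFn_mulL2 n f]
    with x h1 h2 h4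
  rw [h1, h2, h4, ContinuousMap.mul_apply, mul_assoc]

/-- Multiplication by a continuous function, as a bounded operator of `L²`. -/
def mulCLM (m : C(Torus d, ℝ)) : L2 d →L[ℝ] L2 d :=
  LinearMap.mkContinuous ⟨⟨mulL2 m, mulL2_add m⟩, mulL2_smul m⟩ ‖m‖ (norm_mulL2_le m)

theorem mulCLM_apply (m : C(Torus d, ℝ)) (f : L2 d) : mulCLM m f = mulL2 m f := rfl

theorem mulL2_zero (m : C(Torus d, ℝ)) : mulL2 m 0 = 0 := map_zero (mulCLM m)

theorem smul_mulCLM (a : ℝ) (m : C(Torus d, ℝ)) : mulCLM (a • m) = a • mulCLM m :=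
  ContinuousLinearMap.ext fun f => smul_mulL2 a m f

theorem norm_toL2_le (u : H1 d) : ‖u.toL2‖ ≤ ‖u‖ := by
  have := norm_le_of_multiplier (F := fourierH1 d) (G := fourierL2 d) (x := u) (y := u.toL2)
    zero_le_one fun k => by
      rw [fourierL2_apply, fourierH1_apply, norm_mul, Complex.norm_real, one_mul,
        Real.norm_of_nonneg (bracket_pos k).le]
      exact le_mul_of_one_le_left (norm_nonneg _) (one_le_bracket k)
  rwa [one_mul] at this

/-- The inclusion `H¹ ⊆ L²` as a bounded operator. -/
def toL2CLM (d : ℕ) : H1 d →L[ℝ] L2 d :=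
  LinearMap.mkContinuous H1.toL2 1 fun u => by rw [one_mul]; exact norm_toL2_le u

/-- The operator `(w, v) ↦ (0, m w)`. -/
def kickCLM (m : C(Torus d, ℝ)) : State d →L[ℝ] State d :=
  (ContinuousLinearMap.inr ℝ (H1 d) (L2 d)).comp
    ((mulCLM m).comp ((toL2CLM d).comp (ContinuousLinearMap.fst ℝ (H1 d) (L2 d))))

theorem kickCLM_apply (m : C(Torus d, ℝ)) (W : State d) :
    kickCLM m W = (0, mulL2 m W.1.toL2) := rfl

theorem norm_kickCLM_le (m : C(Torus d, ℝ)) : ‖kickCLM m‖ ≤ ‖m‖ := by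
  refine ContinuousLinearMap.opNorm_le_bound _ (norm_nonneg _) fun W => ?_
  rw [kickCLM_apply, Prod.norm_mk, norm_zero, max_eq_right (norm_nonneg _)]
  refine (norm_mulL2_le _ _).trans ?_
  gcongr
  exact (norm_toL2_le _).trans (norm_fst_le W)

/-- The output has zero profile, and only the profile is read. This nilpotency makes the exponential
of a kick equal to `1 + kickCLM m`. -/
theorem kickCLM_kickCLM (m : C(Torus d, ℝ)) (W : State d) : kickCLM m (kickCLM m W) = 0 := by
  rw [kickCLM_apply, kickCLM_apply, map_zero, mulL2_zero]
  rfl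

theorem smul_kickCLM (a : ℝ) (m : C(Torus d, ℝ)) : kickCLM (a • m) = a • kickCLM m := by
  refine ContinuousLinearMap.ext fun W => ?_
  rw [smul_apply, kickCLM_apply, kickCLM_apply, smul_mulL2, Prod.smul_mk, smul_zero]

theorem add_kickCLM (m n : C(Torus d, ℝ)) : kickCLM (m + n) = kickCLM m + kickCLM n := by
  refine ContinuousLinearMap.ext fun W => ?_
  rw [add_apply, kickCLM_apply, kickCLM_apply, kickCLM_apply, add_mulL2, Prod.mk_add_mk, add_zero]

/-- The potential `∑_j q_j μ_j`. -/
def potential (q : Fin (2 * d + 1) → ℝ) : C(Torus d, ℝ) := ∑ j, q j • mu j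

theorem potential_smul (a : ℝ) (q : Fin (2 * d + 1) → ℝ) :
    potential (a • q) = a • potential q := by
  simp [potential, Finset.smul_sum, smul_smul]

theorem norm_potential_le (q : Fin (2 * d + 1) → ℝ) :
    ‖potential q‖ ≤ ‖q‖ * ∑ j, ‖mu (d := d) j‖ := by
  rw [Finset.mul_sum]
  refine norm_sum_le_of_le _ fun j _ => ?_
  rw [norm_smul]
  gcongr
  exact norm_le_pi_norm q j

theorem isSolution_iff {τ : ℝ} {p : ℝ → Fin (2 * d + 1) → ℝ} {W₀ : State d} {W : ℝ → State d} :
    IsSolution τ p W₀ W ↔ IsMild (waveGroup d) (fun s => kickCLM (potential (p s))) τ W₀ W := by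
  constructor
  · rintro ⟨h1, h2⟩
    refine ⟨h1, fun t ht => ?_⟩
    have := h2 t ht
    simp only [freeEvolution_eq] at this
    exact this
  · rintro ⟨h1, h2⟩
    refine ⟨h1, fun t ht => ?_⟩
    have := h2 t ht
    simp only [freeEvolution_eq]
    exact this

/-! ### Attainable propagators -/

/-- `Φ` is the propagator over `[0, τ]` of some piecewise constant control. -/
def Attainable (τ : ℝ) (Φ : State d → State d) : Prop :=
  0 ≤ τ ∧ ∃ p : ℝ → Fin (2 * d + 1) → ℝ, IsPiecewiseConstant τ p ∧ (∃ B, ∀ s, ‖p s‖ ≤ B) ∧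
    ∀ W₀, ∃ W, IsSolution τ p W₀ W ∧ W τ = Φ W₀

/-- The constant depends on the control but not on the data, which gives continuity of propagators
and uniqueness. The bound on `p` is a separate hypothesis since piecewise constancy says nothing
about the values at the breakpoints. -/
theorem exists_dist_le_of_isSolution {τ B : ℝ} {p : ℝ → Fin (2 * d + 1) → ℝ}
    (hτ : 0 ≤ τ) (hB : ∀ s, ‖p s‖ ≤ B) : ∃ C, ∀ W₀ W₀' W W', IsSolution τ p W₀ W →
      IsSolution τ p W₀' W' → ‖W τ - W' τ‖ ≤ C * ‖W₀ - W₀'‖ := by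
  obtain ⟨M, hM0, hM⟩ := (isOperatorGroup_waveGroup (d := d)).bdd τ
  have hB0 : 0 ≤ B := (norm_nonneg _).trans (hB 0)
  set B' := B * ∑ j, ‖mu (d := d) j‖ with hB'
  have hB'0 : 0 ≤ B' := mul_nonneg hB0 (Finset.sum_nonneg fun _ _ => norm_nonneg _)
  refine ⟨M * Real.exp (M * B' * τ), fun W₀ W₀' W W' h h' => ?_⟩
  have := IsMild.dist_le hM0 hM hB'0 (fun s => ?_) (isSolution_iff.1 h) (isSolution_iff.1 h') τ
    ⟨hτ, le_rfl⟩
  · linarith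
  · refine (norm_kickCLM_le _).trans ((norm_potential_le _).trans ?_)
    exact mul_le_mul_of_nonneg_right (hB s) (Finset.sum_nonneg fun _ _ => norm_nonneg _)

theorem Attainable.continuous {τ : ℝ} {Φ : State d → State d} (h : Attainable τ Φ) :
    Continuous Φ := by
  obtain ⟨hτ, p, -, ⟨B, hB⟩, hp⟩ := h
  obtain ⟨C, hC⟩ := exists_dist_le_of_isSolution hτ hB
  refine (LipschitzWith.of_dist_le' (K := C) fun W₀ W₀' => ?_).continuous
  obtain ⟨W, hW, e⟩ := hp W₀
  obtain ⟨W', hW', e'⟩ := hp W₀'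
  rw [dist_eq_norm, dist_eq_norm, ← e, ← e']
  exact hC _ _ _ _ hW hW'

theorem IsPiecewiseConstant.concat {E : Type*} {τ₁ τ₂ : ℝ} {p₁ p₂ : ℝ → E}
    (h₁ : IsPiecewiseConstant τ₁ p₁) (h₂ : IsPiecewiseConstant τ₂ p₂) :
    IsPiecewiseConstant (τ₁ + τ₂) (fun s => if s < τ₁ then p₁ s else p₂ (s - τ₁)) := by
  obtain ⟨n₁, t₁, m₁, z₁, e₁, c₁⟩ := h₁
  obtain ⟨n₂, t₂, m₂, z₂, e₂, c₂⟩ := h₂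
  -- At `i = n₁` the two formulas agree, since `t₁ n₁ = τ₁` and `t₂ 0 = 0`.
  have hval : ∀ i, n₁ ≤ i → (if i ≤ n₁ then t₁ i else τ₁ + t₂ (i - n₁)) = τ₁ + t₂ (i - n₁) := by
    intro i hi
    split_ifs with h
    · have : i = n₁ := le_antisymm h hi
      subst this
      simp [e₁, z₂]
    · rfl
  refine ⟨n₁ + n₂, fun i => if i ≤ n₁ then t₁ i else τ₁ + t₂ (i - n₁), ?_, ?_, ?_, ?_⟩
  · refine monotone_nat_of_le_succ fun i => ?_
    rcases lt_or_ge i n₁ with h | h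
    · rw [if_pos h.le, if_pos (show i + 1 ≤ n₁ from h)]
      exact m₁ (Nat.le_succ i)
    · rw [hval i h, hval (i + 1) (by omega)]
      have := m₂ (show i - n₁ ≤ i + 1 - n₁ by omega)
      linarith
  · simp [z₁]
  · change (if n₁ + n₂ ≤ n₁ then t₁ (n₁ + n₂) else τ₁ + t₂ (n₁ + n₂ - n₁)) = _
    rw [hval _ (by omega)]
    simp [e₂]
  · intro i hi
    rcases lt_or_ge i n₁ with h | h
    · obtain ⟨c, hc⟩ := c₁ i h
      refine ⟨c, fun s hs => ?_⟩
      simp only [if_pos h.le, if_pos (show i + 1 ≤ n₁ from h)] at hs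
      have : s < τ₁ := hs.2.trans_le (e₁ ▸ m₁ (show i + 1 ≤ n₁ from h))
      exact (if_pos this).trans (hc s hs)
    · obtain ⟨c, hc⟩ := c₂ (i - n₁) (by omega)
      refine ⟨c, fun s hs => ?_⟩
      have hs' : s ∈ Ioo (τ₁ + t₂ (i - n₁)) (τ₁ + t₂ (i + 1 - n₁)) := by
        rw [← hval i h, ← hval (i + 1) (by omega)]
        exact hs
      rw [show i + 1 - n₁ = i - n₁ + 1 by omega] at hs'
      have h0 : 0 ≤ t₂ (i - n₁) := z₂ ▸ m₂ (Nat.zero_le _)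
      have h1 := hs'.1
      have h2 := hs'.2
      exact (if_neg (by linarith)).trans (hc _ ⟨by linarith, by linarith⟩)

theorem Attainable.comp {τ₁ τ₂ : ℝ} {Φ₁ Φ₂ : State d → State d} (h₂ : Attainable τ₂ Φ₂)
    (h₁ : Attainable τ₁ Φ₁) : Attainable (τ₁ + τ₂) (fun W => Φ₂ (Φ₁ W)) := by
  obtain ⟨hτ₁, p₁, c₁, ⟨B₁, hB₁⟩, hp₁⟩ := h₁
  obtain ⟨hτ₂, p₂, c₂, ⟨B₂, hB₂⟩, hp₂⟩ := h₂
  refine ⟨add_nonneg hτ₁ hτ₂, _, c₁.concat c₂, ⟨max B₁ B₂, fun s => ?_⟩, fun W₀ => ?_⟩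
  · split_ifs
    · exact (hB₁ _).trans (le_max_left _ _)
    · exact (hB₂ _).trans (le_max_right _ _)
  · obtain ⟨W, hW, e⟩ := hp₁ W₀
    obtain ⟨V, hV, e'⟩ := hp₂ (W τ₁)
    have hV0 : V 0 = W τ₁ := by
      have := ((isSolution_iff.1 hV).duhamel 0 ⟨le_rfl, hτ₂⟩).2
      simpa [waveGroup_zero] using this
    refine ⟨fun t => if t ≤ τ₁ then W t else V (t - τ₁), isSolution_iff.2 ?_, ?_⟩
    · have := IsMild.concat isOperatorGroup_waveGroup hτ₁ hτ₂ (isSolution_iff.1 hW)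
        (isSolution_iff.1 hV)
      convert this using 2 with s
      split_ifs <;> rfl
    · change (if τ₁ + τ₂ ≤ τ₁ then W (τ₁ + τ₂) else V (τ₁ + τ₂ - τ₁)) = Φ₂ (Φ₁ W₀)
      rw [← e, ← e', add_sub_cancel_left]
      -- The first branch occurs only when `τ₂ = 0`, where the second propagator merely returns its
      -- initial state.
      split_ifs with h
      · have : τ₂ = 0 := by linarith
        rw [this, add_zero, hV0]
      · rfl

theorem isPiecewiseConstant_const {E : Type*} {τ : ℝ} (hτ : 0 ≤ τ) (c : E) :
    IsPiecewiseConstant τ (fun _ => c) := by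
  refine ⟨1, fun i => if i = 0 then 0 else τ, ?_, by simp, by simp, fun i _ => ⟨c, fun _ _ => rfl⟩⟩
  refine monotone_nat_of_le_succ fun i => ?_
  split_ifs <;> simp_all

theorem attainable_waveGroup {τ : ℝ} (hτ : 0 ≤ τ) : Attainable τ (waveGroup d τ) := by
  refine ⟨hτ, fun _ => 0, isPiecewiseConstant_const hτ 0, ⟨0, fun s => by simp⟩, fun W₀ =>
    ⟨fun t => waveGroup d t W₀, isSolution_iff.2 ⟨?_, fun t ht => ?_⟩, rfl⟩⟩
  · exact (isOperatorGroup_waveGroup.cont W₀).continuousOn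
  · have h0 : kickCLM (potential (0 : Fin (2 * d + 1) → ℝ)) = 0 := by
      have := potential_smul (d := d) 0 0
      rw [zero_smul, zero_smul] at this
      rw [this, ← zero_smul ℝ (0 : C(Torus d, ℝ)), smul_kickCLM, zero_smul]
    simp [h0]

/-- The factor `9 = 3 * 3` comes from the bound `‖waveGroup d t‖ ≤ 3` for `|t| ≤ 1`, used for both
`t` and `-t` in the interaction picture. -/
theorem exists_attainable_const {q : Fin (2 * d + 1) → ℝ} {δ : ℝ} (hδ : 0 ≤ δ) (hδ1 : δ ≤ 1)
    (hq : 9 * ‖potential q‖ * δ ≤ 1 / 2) :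
    ∃ Φ, Attainable δ Φ ∧ ∀ W₀, ∃ W,
      IsMild (waveGroup d) (fun _ => kickCLM (potential q)) δ W₀ W ∧ W δ = Φ W₀ := by
  have h : ∀ W₀, ∃ W, IsMild (waveGroup d) (fun _ => kickCLM (potential q)) δ W₀ W := by
    refine fun W₀ => exists_isMild (M := 3) isOperatorGroup_waveGroup _ hδ (by norm_num)
      (fun t ht => (norm_waveGroup_le t).trans (by linarith)) (le_trans ?_ hq) W₀
    have := norm_kickCLM_le (potential q)
    gcongr
    linarith
  choose W hW using h
  exact ⟨fun W₀ => W W₀ δ, ⟨hδ, fun _ => q, isPiecewiseConstant_const hδ q, ⟨‖q‖, fun _ => le_rfl⟩,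
    fun W₀ => ⟨W W₀, isSolution_iff.2 (hW W₀), rfl⟩⟩, fun W₀ => ⟨W W₀, hW W₀, rfl⟩⟩

/-- `W'` can be approximated by states reachable from `W` in time less than `T`. -/
def ReachIn (T : ℝ) (W W' : State d) : Prop :=
  ∀ ε > 0, ∃ τ < T, ∃ Φ : State d → State d, Attainable τ Φ ∧ ‖Φ W - W'‖ < ε

/-- The second propagator is fixed first; its continuity at `W'` dictates how accurately `W'` must
be reached. -/
theorem ReachIn.trans {T₁ T₂ : ℝ} {W W' W'' : State d} (h₁ : ReachIn T₁ W W')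
    (h₂ : ReachIn T₂ W' W'') : ReachIn (T₁ + T₂) W W'' := by
  intro ε hε
  obtain ⟨τ₂, hτ₂, Φ₂, a₂, e₂⟩ := h₂ (ε / 2) (by positivity)
  obtain ⟨η, hη, hc⟩ := Metric.continuousAt_iff.1 a₂.continuous.continuousAt (ε / 2)
    (by positivity)
  obtain ⟨τ₁, hτ₁, Φ₁, a₁, e₁⟩ := h₁ η hη
  refine ⟨τ₁ + τ₂, by linarith, _, a₂.comp a₁, ?_⟩
  have h := hc (x := Φ₁ W) (by rwa [dist_eq_norm])
  rw [dist_eq_norm] at h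
  have := norm_sub_le_norm_sub_add_norm_sub (Φ₂ (Φ₁ W)) (Φ₂ W') W''
  linarith

theorem reachIn_of_forall_exists {T : ℝ} {W W' : State d}
    (h : ∀ ε > 0, ∃ W'', ReachIn T W W'' ∧ ‖W'' - W'‖ < ε) : ReachIn T W W' := by
  intro ε hε
  obtain ⟨W'', h1, h2⟩ := h (ε / 2) (by positivity)
  obtain ⟨τ, hτ, Φ, a, e⟩ := h1 (ε / 2) (by positivity)
  refine ⟨τ, hτ, Φ, a, ?_⟩
  have := norm_sub_le_norm_sub_add_norm_sub (Φ W) W'' W'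
  linarith

theorem reachIn_waveGroup {τ T : ℝ} (hτ : 0 ≤ τ) (hT : τ < T) (W : State d) :
    ReachIn T W (waveGroup d τ W) := fun ε hε =>
  ⟨τ, hT, _, attainable_waveGroup hτ, by simpa using hε⟩

/-! ### Potentials that can be applied instantaneously -/

/-- The states `(w, v + f w)` are approximately reachable from `(w, v)` in arbitrarily small time. -/
def Kickable (f : C(Torus d, ℝ)) : Prop :=
  ∀ (W : State d) (T : ℝ), 0 < T → ReachIn T W (W + kickCLM f W)

/-- The first kick leaves the profile untouched, so the second adds its increment to the velocity
independently. -/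
theorem Kickable.add {f g : C(Torus d, ℝ)} (hf : Kickable f) (hg : Kickable g) :
    Kickable (f + g) := by
  intro W T hT
  have := (hf W (T / 2) (by positivity)).trans (hg _ (T / 2) (by positivity))
  rw [add_halves] at this
  convert this using 1
  rw [add_kickCLM, add_apply, map_add, add_assoc]
  congr 2
  simp [kickCLM_apply, mulL2_zero]

theorem kickable_zero : Kickable (0 : C(Torus d, ℝ)) := by
  intro W T hT
  have h0 : kickCLM (0 : C(Torus d, ℝ)) = 0 := by
    rw [← zero_smul ℝ (0 : C(Torus d, ℝ)), smul_kickCLM, zero_smul]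
  have := reachIn_waveGroup le_rfl hT W
  simpa [h0, waveGroup_zero] using this

theorem Kickable.nsmul {f : C(Torus d, ℝ)} (hf : Kickable f) (n : ℕ) : Kickable (n • f) := by
  induction n with
  | zero => simpa using kickable_zero
  | succ n ih =>
    rw [succ_nsmul]
    exact ih.add hf

/-- The impulse `δ⁻¹ q` on `[0, δ]` has total mass independent of `δ`, so shortening it does not
help the existence criterion. The smallness is imposed on `q` and removed afterwards by repeating
small kicks. -/
theorem kickable_potential_of_norm_le {q : Fin (2 * d + 1) → ℝ}
    (hq : 9 * ‖potential q‖ ≤ 1 / 2) : Kickable (potential q) := by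
  intro W T hT ε hε
  obtain ⟨δ₀, hδ₀, h⟩ := IsMild.impulse_limit isOperatorGroup_waveGroup
    (kickCLM_kickCLM (potential q)) W hε
  set δ := min 1 (min T δ₀) / 2 with hδ
  have hpos : 0 < min 1 (min T δ₀) := by positivity
  have h1 : min 1 (min T δ₀) ≤ 1 := min_le_left _ _
  have h2 : min 1 (min T δ₀) ≤ T := (min_le_right _ _).trans (min_le_left _ _)
  have h3 : min 1 (min T δ₀) ≤ δ₀ := (min_le_right _ _).trans (min_le_right _ _)
  have hδpos : 0 < δ := by positivity
  obtain ⟨Φ, hΦ, hsol⟩ := exists_attainable_const (q := δ⁻¹ • q) hδpos.le (by linarith) (by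
    rw [potential_smul, norm_smul, Real.norm_of_nonneg (by positivity)]
    calc _ = 9 * ‖potential q‖ := by field_simp
      _ ≤ _ := hq)
  refine ⟨δ, by linarith, Φ, hΦ, ?_⟩
  obtain ⟨V, hV, e⟩ := hsol W
  rw [potential_smul, smul_kickCLM] at hV
  rw [← e]
  exact h δ hδpos (by linarith) V hV

theorem kickable_potential (q : Fin (2 * d + 1) → ℝ) : Kickable (potential q) := by
  obtain ⟨n, hn⟩ := exists_nat_gt (18 * ‖potential q‖)
  have hn0 : (0 : ℝ) < n := lt_of_le_of_lt (by positivity) hn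
  have h : Kickable (potential ((n : ℝ)⁻¹ • q)) := by
    refine kickable_potential_of_norm_le ?_
    rw [potential_smul, norm_smul, Real.norm_of_nonneg (by positivity), ← mul_assoc,
      mul_comm 9, mul_assoc, inv_mul_le_iff₀ hn0]
    linarith
  have e : potential q = n • potential ((n : ℝ)⁻¹ • q) := by
    rw [potential_smul, ← Nat.cast_smul_eq_nsmul ℝ, smul_smul, mul_inv_cancel₀ hn0.ne', one_smul]
  rw [e]
  exact h.nsmul n

/-- Expand the product. The two singular terms `± s⁻¹ φ w` in the velocity cancel, most corrections
are `O(s)`, and the wave transport of the kick `s⁻¹ φ w` into the profile, multiplied by `-s⁻¹ φ`,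
leaves `-φ² w`. The function `g` encodes that `φ w` lies in `H¹`, which the `O(s)` bounds need. -/
theorem tendsto_conjugated_waveGroup {φ : C(Torus d, ℝ)} (W : State d) (g : H1 d)
    (hg : g.toL2 = mulL2 φ W.1.toL2) :
    Tendsto (fun s : ℝ =>
      (1 + kickCLM (-s⁻¹ • φ)) (waveGroup d (s ^ 2) ((1 + kickCLM (s⁻¹ • φ)) W)))
      (𝓝[>] 0) (𝓝 (W + kickCLM (-(φ * φ)) W)) := by
  obtain ⟨w, v⟩ := W
  have hs : Tendsto (fun s : ℝ => s) (𝓝[>] 0) (𝓝 0) := nhdsWithin_le_nhds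
  have hsq : Tendsto (fun s : ℝ => s ^ 2) (𝓝[>] 0) (𝓝 0) := by
    have := hs.pow 2
    simpa using this
  have hsq' : Tendsto (fun s : ℝ => s ^ 2) (𝓝[>] 0) (𝓝[≠] 0) := by
    refine tendsto_nhdsWithin_iff.2 ⟨hsq, ?_⟩
    filter_upwards [self_mem_nhdsWithin] with s hs
    exact pow_ne_zero 2 (ne_of_gt hs)
  have hpos : ∀ᶠ s : ℝ in 𝓝[>] 0, 0 < s := self_mem_nhdsWithin
  have small : ∀ {E : Type} [NormedAddCommGroup E] [NormedSpace ℝ E] (y : ℝ → E) (C : ℝ),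
      (∀ t, ‖y t‖ ≤ |t| * C) → Tendsto (fun s : ℝ => s⁻¹ • y (s ^ 2)) (𝓝[>] 0) (𝓝 0) := by
    intro E _ _ y C hy
    have hC : Tendsto (fun s : ℝ => s * C) (𝓝[>] 0) (𝓝 0) := by
      simpa using hs.mul_const C
    refine squeeze_zero_norm' ?_ hC
    filter_upwards [hpos] with s hs
    rw [norm_smul, norm_inv, Real.norm_of_nonneg hs.le, inv_mul_le_iff₀ hs]
    refine (hy _).trans (le_of_eq ?_)
    rw [abs_of_nonneg (sq_nonneg s)]
    ring
  have a1 : Tendsto (fun s : ℝ => cosH1 d (s ^ 2) w) (𝓝[>] 0) (𝓝 w) := by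
    have h := ((continuous_cosH1 w).tendsto 0).comp hsq
    have e : cosH1 d 0 w = w := H1_ext fun k => by simp [coef_cosH1]
    rwa [e] at h
  have a2 : Tendsto (fun s : ℝ => sinOp d (s ^ 2) v) (𝓝[>] 0) (𝓝 0) := by
    have h := ((continuous_sinOp v).tendsto 0).comp hsq
    have e : sinOp d 0 v = 0 := H1_ext fun k => by simp [coef_sinOp, sinDiv_zero, coef_zero]
    rwa [e] at h
  have a3 : Tendsto (fun s : ℝ => s⁻¹ • sinOp d (s ^ 2) g.toL2) (𝓝[>] 0) (𝓝 0) :=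
    small (fun t => sinOp d t g.toL2) ‖g‖ fun t => norm_sinOp_toL2_le t g
  have b1 : Tendsto (fun s : ℝ => dcosOp d (s ^ 2) w) (𝓝[>] 0) (𝓝 0) := by
    have h := ((continuous_dcosOp w).tendsto 0).comp hsq
    have e : dcosOp d 0 w = 0 := L2_ext fun k => by simp [coef_dcosOp, coef_zero]
    rwa [e] at h
  have b2 : Tendsto (fun s : ℝ => cosL2 d (s ^ 2) v) (𝓝[>] 0) (𝓝 v) := by
    have h := ((continuous_cosL2 v).tendsto 0).comp hsq
    have e : cosL2 d 0 v = v := L2_ext fun k => by simp [coef_cosL2]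
    rwa [e] at h
  have b3 : Tendsto (fun s : ℝ => s⁻¹ • (cosL2 d (s ^ 2) g.toL2 - g.toL2)) (𝓝[>] 0) (𝓝 0) :=
    small (fun t => cosL2 d t g.toL2 - g.toL2) ‖g‖ fun t => norm_cosL2_sub_le t g
  have b4 : Tendsto (fun s : ℝ => mulCLM φ (s⁻¹ • (cosL2 d (s ^ 2) w.toL2 - w.toL2)))
      (𝓝[>] 0) (𝓝 (mulCLM φ 0)) :=
    ((mulCLM φ).continuous.tendsto 0).comp
      (small (fun t => cosL2 d t w.toL2 - w.toL2) ‖w‖ fun t => norm_cosL2_sub_le t w)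
  have b5 : Tendsto (fun s : ℝ => mulCLM φ (s⁻¹ • (sinOp d (s ^ 2) v).toL2))
      (𝓝[>] 0) (𝓝 (mulCLM φ 0)) :=
    ((mulCLM φ).continuous.tendsto 0).comp
      (small (fun t => (sinOp d t v).toL2) ‖v‖ fun t => norm_toL2_sinOp_le t v)
  -- The surviving quadratic term: `s⁻¹` from each kick matches the elapsed time `s²`.
  have b6 : Tendsto (fun s : ℝ => mulCLM φ ((s ^ 2)⁻¹ • (sinOp d (s ^ 2) g.toL2).toL2))
      (𝓝[>] 0) (𝓝 (mulCLM φ g.toL2)) :=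
    ((mulCLM φ).continuous.tendsto _).comp ((tendsto_inv_smul_toL2_sinOp g.toL2).comp hsq')
  have hA := (a1.add a2).add a3
  have hB := ((((b1.add b2).add b3).sub b4).sub b5).sub b6
  have hlim : ((w, v) + kickCLM (-(φ * φ)) (w, v) : State d) = (w + 0 + 0,
      0 + v + 0 - mulCLM φ 0 - mulCLM φ 0 - mulCLM φ g.toL2) := by
    rw [kickCLM_apply, ← neg_one_smul ℝ, smul_mulL2, mul_mulL2, ← hg]
    refine Prod.ext (by simp) ?_
    simp [mulCLM_apply, mulL2_zero, sub_eq_add_neg]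
  rw [hlim]
  refine (hA.prodMk_nhds hB).congr fun s => ?_
  have hg' : mulCLM φ w.toL2 = g.toL2 := hg.symm
  simp only [add_apply, one_apply_eq_self, kickCLM_apply, waveGroup_apply, Prod.mk_add_mk, add_zero,
    ← mulCLM_apply, smul_mulCLM, smul_apply, map_add, map_smul, toL2_cosH1, map_sub, smul_sub, hg']
  refine Prod.ext (by simp only; abel) ?_
  simp only [sq, mul_inv, mul_smul, neg_smul, smul_neg]
  abel

/-- Kick, wait, kick back, each within `T / 3`. All real multiples of `φ` are required because the
amplitudes are `± s⁻¹` with `s` arbitrarily small. -/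
theorem Kickable.neg_sq {φ : C(Torus d, ℝ)} (hst : ∀ u ∈ H1Submodule d, mulL2 φ u ∈ H1Submodule d)
    (hφ : ∀ a : ℝ, Kickable (a • φ)) : Kickable (-(φ * φ)) := by
  intro W T hT
  refine reachIn_of_forall_exists fun ε hε => ?_
  have hlim := tendsto_conjugated_waveGroup W ⟨_, hst _ W.1.2⟩ rfl
  have h1 := (Metric.tendsto_nhds.1 hlim) ε hε
  have h2 : ∀ᶠ s : ℝ in 𝓝[>] 0, s ^ 2 < T / 3 := by
    have : Tendsto (fun s : ℝ => s ^ 2) (𝓝 0) (𝓝 (0 ^ 2)) := (continuous_pow 2).tendsto 0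
    have := this.eventually (gt_mem_nhds (show (0:ℝ) ^ 2 < T / 3 by norm_num; exact hT))
    exact nhdsWithin_le_nhds this
  obtain ⟨s, hs1, hs2⟩ := (h1.and h2).exists
  refine ⟨_, ?_, by rw [← dist_eq_norm]; exact hs1⟩
  have r1 := hφ s⁻¹ W (T / 3) (by positivity)
  have r2 := r1.trans (reachIn_waveGroup (sq_nonneg s) hs2 _)
  have r3 := r2.trans (hφ (-s⁻¹) _ (T / 3) (by positivity))
  rw [add_thirds] at r3
  exact r3

/-! ### Trigonometric polynomials as potentials -/

/-- The real function `x ↦ Re (c e^{ik·x})`. -/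
def trig (k : Fin d → ℤ) (c : ℂ) : C(Torus d, ℝ) where
  toFun x := (c * expo k x).re

theorem trig_apply (k : Fin d → ℤ) (c : ℂ) (x : Torus d) : trig k c x = (c * expo k x).re := rfl

theorem smul_trig (a : ℝ) (k : Fin d → ℤ) (c : ℂ) : a • trig k c = trig k (a * c) := by
  ext x
  simp only [ContinuousMap.smul_apply, trig_apply, smul_eq_mul, mul_assoc, Complex.re_ofReal_mul]

theorem modeFun_eq_trig (k : Fin d → ℤ) (c : ℂ) : modeFun k c = trig k (c * normConst d) := by
  ext x
  change (c * phi k x).re = (c * normConst d * expo k x).re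
  rw [phi_apply, mul_assoc]

theorem coef_mulL2_trig (k : Fin d → ℤ) (c : ℂ) (f : L2 d) (j : Fin d → ℤ) :
    coef (mulL2 (trig k c) f) j = (c * coef f (j - k) + conj c * coef f (j + k)) / 2 := by
  have hint : ∀ m : Fin d → ℤ, Integrable fun x => (f x : ℂ) * conj (phi m x) := fun m =>
    (integrable_mul_conj_phi (toComplex d f) m).congr (by
      filter_upwards [coeFn_toComplex f] with x hx
      rw [hx])
  simp only [coef]
  rw [← integral_const_mul, ← integral_const_mul,
    ← integral_add ((hint _).const_mul _) ((hint _).const_mul _), ← integral_div]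
  refine integral_congr_ae ?_
  filter_upwards [coeFn_mulL2 (trig k c) f] with x hx
  rw [hx, trig_apply, Complex.ofReal_mul, Complex.re_eq_add_conj]
  simp only [phi_apply, sub_eq_add_neg, expo_add, expo_neg, map_mul, Complex.conj_ofReal,
    Complex.conj_conj]
  ring

theorem freq_add_le (k j : Fin d → ℤ) : freq (k + j) ≤ freq k + freq j := by
  have e : ∀ m : Fin d → ℤ, freq m = ‖(WithLp.toLp 2 fun i => (m i : ℝ) : EuclideanSpace ℝ (Fin d))‖ := by
    intro m
    rw [EuclideanSpace.norm_eq, freq]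
    simp
  rw [e, e, e]
  refine le_trans (le_of_eq ?_) (norm_add_le _ _)
  congr 1
  ext i
  simp

theorem sq_mul_norm_sq_le {f B p q : ℝ} (hf : 0 ≤ f) (hp : f ≤ B * p) (hq : f ≤ B * q)
    (a b c : ℂ) : f ^ 2 * ‖(c * a + conj c * b) / 2‖ ^ 2
      ≤ B ^ 2 * ‖c‖ ^ 2 * (p ^ 2 * ‖a‖ ^ 2 + q ^ 2 * ‖b‖ ^ 2) := by
  have h1 : ‖(c * a + conj c * b) / 2‖ ≤ (‖c‖ * ‖a‖ + ‖c‖ * ‖b‖) / 2 := by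
    rw [norm_div, Complex.norm_ofNat]
    gcongr
    refine (norm_add_le _ _).trans (le_of_eq ?_)
    rw [norm_mul, norm_mul, RCLike.norm_conj]
  have h2 : f * ‖(c * a + conj c * b) / 2‖ ≤ ‖c‖ * ((B * p * ‖a‖ + B * q * ‖b‖) / 2) :=
    calc _ ≤ f * ((‖c‖ * ‖a‖ + ‖c‖ * ‖b‖) / 2) := by gcongr
      _ = ‖c‖ * ((f * ‖a‖ + f * ‖b‖) / 2) := by ring
      _ ≤ _ := by gcongr
  have h3 : ((B * p * ‖a‖ + B * q * ‖b‖) / 2) ^ 2 ≤ (B * p * ‖a‖) ^ 2 + (B * q * ‖b‖) ^ 2 := by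
    nlinarith [sq_nonneg (B * p * ‖a‖ - B * q * ‖b‖), sq_nonneg (B * p * ‖a‖),
      sq_nonneg (B * q * ‖b‖)]
  calc _ = (f * ‖(c * a + conj c * b) / 2‖) ^ 2 := by ring
    _ ≤ (‖c‖ * ((B * p * ‖a‖ + B * q * ‖b‖) / 2)) ^ 2 := by gcongr
    _ = ‖c‖ ^ 2 * ((B * p * ‖a‖ + B * q * ‖b‖) / 2) ^ 2 := by ring
    _ ≤ ‖c‖ ^ 2 * ((B * p * ‖a‖) ^ 2 + (B * q * ‖b‖) ^ 2) := by gcongr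
    _ = _ := by ring

/-- Multiplication by a character of frequency `k` shifts coefficients by `± k`, and the weights
change by a bounded factor: `|j| ≤ (1 + |k|) ⟨j ∓ k⟩`. -/
theorem mulL2_trig_mem (k : Fin d → ℤ) (c : ℂ) {u : L2 d} (hu : u ∈ H1Submodule d) :
    mulL2 (trig k c) u ∈ H1Submodule d := by
  have hs : Summable fun j => bracket j ^ 2 * ‖coef u j‖ ^ 2 := by
    have hu' : Summable fun j => freq j ^ 2 * ‖coef u j‖ ^ 2 := hu
    refine ((hasSum_coef_sq u).summable.add hu').congr fun j => ?_
    rw [bracket_sq]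
    ring
  have h1 : Summable fun j => bracket (j - k) ^ 2 * ‖coef u (j - k)‖ ^ 2 :=
    hs.comp_injective (sub_left_injective (b := k))
  have h2 : Summable fun j => bracket (j + k) ^ 2 * ‖coef u (j + k)‖ ^ 2 :=
    hs.comp_injective (add_left_injective k)
  change Summable fun j => freq j ^ 2 * ‖coef (mulL2 (trig k c) u) j‖ ^ 2
  refine Summable.of_nonneg_of_le (fun j => by positivity) (fun j => ?_)
    ((h1.add h2).mul_left ((1 + freq k) ^ 2 * ‖c‖ ^ 2))
  have hk := freq_nonneg k
  have f1 : freq j ≤ (1 + freq k) * bracket (j - k) := by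
    have := freq_add_le (j - k) k
    rw [sub_add_cancel] at this
    nlinarith [freq_le_bracket (j - k), one_le_bracket (j - k)]
  have f2 : freq j ≤ (1 + freq k) * bracket (j + k) := by
    have := freq_add_le (j + k) (-k)
    rw [add_neg_cancel_right, freq_neg] at this
    nlinarith [freq_le_bracket (j + k), one_le_bracket (j + k)]
  rw [coef_mulL2_trig]
  exact sq_mul_norm_sq_le (freq_nonneg j) f1 f2 _ _ _

/-! ### Generating all frequencies from the control potentials -/

theorem kickable_smul_mu (a : ℝ) (j : Fin (2 * d + 1)) : Kickable (a • mu (d := d) j) := by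
  have : a • mu (d := d) j = potential (Pi.single j a) := by
    rw [potential, Finset.sum_eq_single j]
    · simp
    · intro i _ hi
      simp [Pi.single_eq_of_ne hi]
    · simp
  rw [this]
  exact kickable_potential _

theorem mu_zero : mu (d := d) 0 = 1 := by simp [mu]

theorem exists_mu_eq_cosFun (i : Fin d) : ∃ j, mu j = cosFun i := by
  refine ⟨⟨2 * i + 1, by omega⟩, ?_⟩
  have h0 : (⟨2 * i + 1, by omega⟩ : Fin (2 * d + 1)) ≠ 0 := by
    simp [Fin.ext_iff]
  rw [mu, dif_neg h0, if_pos (by simp)]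
  congr 1
  ext
  simp

theorem exists_mu_eq_sinFun (i : Fin d) : ∃ j, mu j = sinFun i := by
  refine ⟨⟨2 * i + 2, by omega⟩, ?_⟩
  have h0 : (⟨2 * i + 2, by omega⟩ : Fin (2 * d + 1)) ≠ 0 := by
    simp [Fin.ext_iff]
  rw [mu, dif_neg h0, if_neg (by simp [Nat.odd_add])]
  congr 1
  ext
  simp
  omega

theorem kickable_const (a : ℝ) : Kickable (a • (1 : C(Torus d, ℝ))) := by
  rw [← mu_zero]
  exact kickable_smul_mu a 0

theorem trig_zero (c : ℂ) : trig (0 : Fin d → ℤ) c = c.re • (1 : C(Torus d, ℝ)) := by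
  ext x
  simp [trig_apply, expo_zero]

theorem trig_single (i : Fin d) (c : ℂ) :
    trig (Pi.single i 1) c = c.re • cosFun i + (-c.im) • sinFun i := by
  ext x
  obtain ⟨θ, hθ⟩ := QuotientAddGroup.mk_surjective (x i)
  have h1 : cosFun i x = Real.cos θ := by
    change Real.Angle.cos (x i) = _
    rw [← hθ]
    exact Real.Angle.cos_coe θ
  have h2 : sinFun i x = Real.sin θ := by
    change Real.Angle.sin (x i) = _
    rw [← hθ]
    exact Real.Angle.sin_coe θ
  have h3 : expo (Pi.single i 1) x = Complex.exp (θ * Complex.I) := by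
    rw [expo_single, ← hθ]
    rw [show (QuotientAddGroup.mk θ : AddCircle (2 * Real.pi)) = (θ : AddCircle (2 * Real.pi)) from rfl,
      fourier_coe_apply]
    congr 1
    have : (Real.pi : ℂ) ≠ 0 := by exact_mod_cast Real.pi_ne_zero
    push_cast
    field_simp
  rw [trig_apply, h3, Complex.exp_mul_I]
  simp only [ContinuousMap.add_apply, ContinuousMap.smul_apply, h1, h2, smul_eq_mul, Complex.mul_re,
    Complex.add_re, Complex.add_im, Complex.mul_im, Complex.I_re, Complex.I_im,
    Complex.cos_ofReal_re, Complex.cos_ofReal_im, Complex.sin_ofReal_re, Complex.sin_ofReal_im]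
  ring

theorem normSq_expo (k : Fin d → ℤ) (x : Torus d) : (expo k x).re ^ 2 + (expo k x).im ^ 2 = 1 := by
  have := expo_mul_conj k x
  rw [Complex.mul_conj, Complex.normSq_apply] at this
  have h2 : (expo k x).re * (expo k x).re + (expo k x).im * (expo k x).im = 1 := by
    exact_mod_cast this
  linarith

/-- With `z = c e^{ik·x}` and `u = e^{im·x}`, the squares of `Re z + Re u` and `Im z + Im u` sum to
`|z + u|² = |c|² + 1 + 2 Re (z ū)`. Two negative squares and a constant kick thus produce frequency
`k - m`. -/
theorem kickable_trig_sub {k m : Fin d → ℤ} (hk : ∀ c, Kickable (trig k c))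
    (hm : ∀ c, Kickable (trig m c)) (c : ℂ) : Kickable (trig (k - m) c) := by
  have main : ∀ c : ℂ, Kickable (trig (k - m) (-2 * c)) := by
    intro c
    have hsq : ∀ b b' : ℂ, Kickable (-((trig k b + trig m b') * (trig k b + trig m b'))) := by
      intro b b'
      refine Kickable.neg_sq (fun u hu => ?_) fun a => ?_
      · rw [add_mulL2]
        exact add_mem (mulL2_trig_mem k b hu) (mulL2_trig_mem m b' hu)
      · rw [smul_add, smul_trig, smul_trig]
        exact (hk _).add (hm _)
    have := ((hsq c 1).add (hsq (-Complex.I * c) (-Complex.I))).add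
      (kickable_const (c.re ^ 2 + c.im ^ 2 + 1))
    convert this using 1
    ext x
    have h1 := normSq_expo k x
    have h2 := normSq_expo m x
    simp only [trig_apply, ContinuousMap.add_apply, ContinuousMap.neg_apply, ContinuousMap.mul_apply,
      ContinuousMap.smul_apply, ContinuousMap.one_apply, smul_eq_mul, sub_eq_add_neg, expo_add,
      expo_neg, Complex.mul_re, Complex.mul_im, Complex.neg_re, Complex.neg_im, Complex.I_re,
      Complex.I_im, Complex.one_re, Complex.one_im, Complex.conj_re, Complex.conj_im]
    simp
    linear_combination (c.re ^ 2 + c.im ^ 2) * h1 + h2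
  have := main (-c / 2)
  convert this using 2
  ring

theorem kickable_trig (k : Fin d → ℤ) (c : ℂ) : Kickable (trig k c) := by
  have h0 : ∀ c, Kickable (trig (0 : Fin d → ℤ) c) := fun c => by
    rw [trig_zero]
    exact kickable_const _
  -- Closure under differences and the presence of `0` make the frequencies a subgroup: `k + m = k -
  -- (0 - m)`.
  let G : AddSubgroup (Fin d → ℤ) :=
    { carrier := {k | ∀ c, Kickable (trig k c)}
      zero_mem' := h0
      add_mem' := fun {k m} hk hm => by
        have := kickable_trig_sub hk (kickable_trig_sub h0 hm)
        simpa using this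
      neg_mem' := fun {k} hk => by
        have := kickable_trig_sub h0 hk
        simpa using this }
  have hsingle : ∀ i : Fin d, Pi.single i (1 : ℤ) ∈ G := by
    intro i c
    rw [trig_single]
    obtain ⟨j, hj⟩ := exists_mu_eq_cosFun i
    obtain ⟨j', hj'⟩ := exists_mu_eq_sinFun i
    rw [← hj, ← hj']
    exact (kickable_smul_mu _ j).add (kickable_smul_mu _ j')
  have hk : k ∈ G := by
    rw [← Finset.univ_sum_single k]
    refine sum_mem fun i _ => ?_
    have : Pi.single i (k i) = k i • (Pi.single i (1 : ℤ) : Fin d → ℤ) := by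
      rw [← Pi.single_smul]
      simp
    rw [this]
    exact zsmul_mem (hsingle i) _
  exact hk c

/-! ### Trigonometric polynomials vanish on null sets only -/

/-- Multiplied by `e^{iNθ}`, the sum is a polynomial in `e^{iθ}`. Distinct frequencies keep the
coefficient `a i₀` from cancelling, so there are finitely many roots, and `e^{iθ}` determines `θ`.
-/
theorem finite_zeros_fourier {ι : Type*} (S : Finset ι) (a : ι → ℂ) (n : ι → ℤ)
    (hn : Set.InjOn n S) {i₀ : ι} (hi₀ : i₀ ∈ S) (ha : a i₀ ≠ 0) :
    {θ : AddCircle (2 * Real.pi) | ∑ i ∈ S, a i * fourier (n i) θ = 0}.Finite := by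
  classical
  set N : ℤ := ∑ i ∈ S, |n i| with hN
  have hpos : ∀ i ∈ S, 0 ≤ n i + N := by
    intro i hi
    have := Finset.single_le_sum (f := fun i => |n i|) (fun i _ => abs_nonneg _) hi
    have h2 := neg_abs_le (n i)
    linarith
  set P : Polynomial ℂ := ∑ i ∈ S, Polynomial.C (a i) * Polynomial.X ^ (n i + N).toNat with hP
  have hP0 : P ≠ 0 := by
    intro h
    have hc : P.coeff (n i₀ + N).toNat = a i₀ := by
      rw [hP, Polynomial.finsetSum_coeff, Finset.sum_eq_single i₀]
      · simp
      · intro i hi hne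
        rw [Polynomial.coeff_C_mul_X_pow, if_neg]
        intro h
        apply hne
        apply hn hi hi₀
        have h1 := hpos i hi
        have h2 := hpos i₀ hi₀
        omega
      · exact fun h => absurd hi₀ h
    rw [h, Polynomial.coeff_zero] at hc
    exact ha hc.symm
  have hinj : Function.Injective fun θ : AddCircle (2 * Real.pi) => (fourier 1 θ : ℂ) := by
    intro θ θ' h
    simp only [fourier_one] at h
    exact AddCircle.injective_toCircle Real.two_pi_pos.ne' (Circle.ext h)
  refine Set.Finite.subset ((P.roots.toFinset.finite_toSet).preimage hinj.injOn) fun θ hθ => ?_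
  simp only [mem_preimage, Finset.mem_coe, Multiset.mem_toFinset, Polynomial.mem_roots hP0,
    Polynomial.IsRoot.def]
  have hpow : ∀ (k : ℕ), (fourier 1 θ : ℂ) ^ k = fourier (k : ℤ) θ := by
    intro k
    induction k with
    | zero => simp
    | succ k ih => rw [pow_succ, ih, ← fourier_add]; push_cast; rfl
  rw [hP, Polynomial.eval_finsetSum]
  simp only [Polynomial.eval_mul, Polynomial.eval_C, Polynomial.eval_pow, Polynomial.eval_X, hpow]
  calc _ = ∑ i ∈ S, (a i * fourier (n i) θ) * fourier N θ := by
        refine Finset.sum_congr rfl fun i hi => ?_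
        rw [Int.toNat_of_nonneg (hpos i hi), fourier_add, mul_assoc]
    _ = 0 := by
        rw [← Finset.sum_mul, show ∑ i ∈ S, a i * fourier (n i) θ = 0 from hθ, zero_mul]

/-- Take `v = (1, N, N², …)`. Then `k · v` is a polynomial in `N` with coefficient vector `k`, and
`N` has only to avoid the roots attached to the nonzero differences of elements of `S`. -/
theorem exists_injOn_dot (S : Finset (Fin d → ℤ)) :
    ∃ v : Fin d → ℤ, Set.InjOn (fun k : Fin d → ℤ => ∑ i, k i * v i) S := by
  classical
  let Q : (Fin d → ℤ) → Polynomial ℤ := fun k => ∑ i, Polynomial.C (k i) * Polynomial.X ^ (i : ℕ)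
  have hQ : ∀ k, k ≠ 0 → Q k ≠ 0 := by
    intro k hk h
    obtain ⟨i, hi⟩ := Function.ne_iff.1 hk
    apply hi
    have hc : (Q k).coeff i = k i := by
      simp only [Q]
      rw [Polynomial.finsetSum_coeff, Finset.sum_eq_single i]
      · simp
      · intro j _ hj
        rw [Polynomial.coeff_C_mul_X_pow, if_neg]
        exact fun h => hj (Fin.ext h).symm
      · simp
    rw [← hc, h]
    simp
  let R : Polynomial ℤ := ∏ p ∈ (S ×ˢ S).filter (fun p => p.1 ≠ p.2), Q (p.1 - p.2)
  have hR : R ≠ 0 := Finset.prod_ne_zero_iff.2 fun p hp =>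
    hQ _ (sub_ne_zero.2 (Finset.mem_filter.1 hp).2)
  obtain ⟨N, hN⟩ : ∃ N : ℤ, R.eval N ≠ 0 := by
    by_contra! h
    exact hR (Polynomial.funext fun N => by simpa using h N)
  refine ⟨fun i => N ^ (i : ℕ), fun k hk m hm h => ?_⟩
  by_contra hne
  apply hN
  simp only [R]
  rw [Polynomial.eval_prod]
  refine Finset.prod_eq_zero (i := (k, m)) (by simp [hne]; exact ⟨hk, hm⟩) ?_
  simp only [Q, Polynomial.eval_finsetSum, Polynomial.eval_mul, Polynomial.eval_C,
    Polynomial.eval_pow, Polynomial.eval_X, Pi.sub_apply, sub_mul, Finset.sum_sub_distrib]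
  simp only at h
  rw [h, sub_self]

theorem nullSingletonClass_addCircle :
    NullSingletonClass (volume : Measure (AddCircle (2 * Real.pi))) where
  measure_singleton x := by
    rw [← Metric.closedBall_zero, AddCircle.volume_closedBall]
    simp [Real.pi_pos.le]

theorem fourier_sum {ι : Type*} (s : Finset ι) (n : ι → ℤ) (θ : AddCircle (2 * Real.pi)) :
    (fourier (∑ i ∈ s, n i) θ : ℂ) = ∏ i ∈ s, fourier (n i) θ := by
  classical
  induction s using Finset.induction_on with
  | empty => simp
  | insert i s hi ih => rw [Finset.sum_insert hi, Finset.prod_insert hi, fourier_add, ih]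

theorem expo_shift (k v : Fin d → ℤ) (x : Torus d) (θ : AddCircle (2 * Real.pi)) :
    expo k (x + fun i => v i • θ) = expo k x * fourier (∑ i, k i * v i) θ := by
  rw [fourier_sum]
  simp only [expo, ContinuousMap.coe_mk, ← Finset.prod_mul_distrib]
  refine Finset.prod_congr rfl fun i _ => ?_
  simp only [fourier_apply, Pi.add_apply, smul_add, smul_smul, AddCircle.toCircle_add,
    Circle.coe_mul]

/-- Along each line `θ ↦ x + θ v` in a direction separating the frequencies, the sum has finitely
many zeros. Fubini and translation invariance then make the zero set null. -/
theorem ae_trig_sum_ne_zero (S : Finset (Fin d → ℤ)) (c : (Fin d → ℤ) → ℂ) {k₀ : Fin d → ℤ}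
    (hk₀ : k₀ ∈ S) (hc : c k₀ ≠ 0) :
    ∀ᵐ x : Torus d, ∑ k ∈ S, c k * expo k x ≠ 0 := by
  obtain ⟨v, hv⟩ := exists_injOn_dot S
  set F : Torus d → ℂ := fun x => ∑ k ∈ S, c k * expo k x with hF
  have hFc : Continuous F := by fun_prop
  have hmeas : MeasurableSet {x | F x = 0} := (isClosed_eq hFc continuous_const).measurableSet
  set E : Set (Torus d × AddCircle (2 * Real.pi)) :=
    {p | F (p.1 + fun i => v i • p.2) = 0} with hE
  have hEm : MeasurableSet E :=
    (isClosed_eq (hFc.comp (by fun_prop)) continuous_const).measurableSet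
  have hE0 : ((volume : Measure (Torus d)).prod
      (volume : Measure (AddCircle (2 * Real.pi)))) E = 0 := by
    rw [Measure.measure_prod_null hEm]
    refine Eventually.of_forall fun x => ?_
    have := nullSingletonClass_addCircle
    refine Set.Finite.measure_zero ?_ _
    have := finite_zeros_fourier S (fun k => c k * expo k x) (fun k => ∑ i, k i * v i) hv hk₀
      (mul_ne_zero hc fun h => by have := expo_mul_conj k₀ x; simp [h] at this)
    refine this.subset fun θ hθ => ?_
    simp only [mem_preimage, hE, mem_ofPred_eq, hF, expo_shift] at hθ
    simpa only [mem_ofPred_eq, mul_assoc] using hθ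
  rw [Measure.prod_apply_symm hEm] at hE0
  -- Every slice at fixed `θ` is a translate of the zero set, so the product measure is that of the
  -- zero set times the length of the circle.
  have hslice : ∀ θ : AddCircle (2 * Real.pi),
      (volume : Measure (Torus d)) ((fun x => (x, θ)) ⁻¹' E) = volume {x | F x = 0} := fun θ =>
    measure_preimage_add_right volume (fun i => v i • θ) {x | F x = 0}
  simp only [hslice, lintegral_const, mul_eq_zero] at hE0
  rw [ae_iff]
  simp only [not_not]
  refine hE0.resolve_right ?_
  rw [AddCircle.measure_univ]
  simp [Real.pi_pos]

/-! ### Control of the velocity -/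

theorem FinitelyManyModes.exists_finset {w : L2 d} (hw : FinitelyManyModes w) :
    ∃ S : Finset (Fin d → ℤ), ∀ k, k ∈ S ↔ coef w k ≠ 0 :=
  ⟨Set.Finite.toFinset hw, fun _ => Set.Finite.mem_toFinset hw⟩

theorem ae_ne_zero_of_finitelyManyModes {w : L2 d} (hw : FinitelyManyModes w) (hne : w ≠ 0) :
    ∀ᵐ x, w x ≠ 0 := by
  obtain ⟨S, hS⟩ := hw.exists_finset
  have hsum : toComplex d w = ∑ k ∈ S, coef w k • phiLp k := by
    have h := (phiBasis d).hasSum_repr (toComplex d w)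
    simp only [repr_toComplex, phiBasis_apply] at h
    refine h.unique (hasSum_sum_of_ne_finset_zero fun k hk => ?_)
    have : coef w k = 0 := by simpa [hS] using hk
    rw [this, zero_smul]
  obtain ⟨k₀, hk₀⟩ : ∃ k, coef w k ≠ 0 := by
    by_contra! h
    exact hne (L2_ext fun k => by rw [h, coef_zero])
  have h1 : ∀ᵐ x : Torus d, ∀ k ∈ S, (phiLp k : Torus d → ℂ) x = phi k x := by
    rw [eventually_all_finset]
    exact fun k _ => coeFn_phiLp k
  have h2 : ∀ᵐ x : Torus d, ∀ k ∈ S, (coef w k • phiLp k : Lp ℂ 2 (volume : Measure (Torus d))) x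
      = coef w k * phiLp k x := by
    rw [eventually_all_finset]
    intro k _
    filter_upwards [Lp.coeFn_smul (coef w k) (phiLp k)] with x hx
    rw [hx, Pi.smul_apply, smul_eq_mul]
  filter_upwards [coeFn_toComplex w, h1, h2,
    Lp.coeFn_finsetSum S (fun k => coef w k • phiLp k),
    ae_trig_sum_ne_zero S (fun k => coef w k) (k₀ := k₀) ((hS k₀).2 hk₀) hk₀]
    with x e1 e2 e3 e4 e5 h0
  apply e5
  rw [h0, hsum, e4, Finset.sum_apply, Complex.ofReal_zero] at e1
  have hA : (normConst d : ℂ) ≠ 0 := by exact_mod_cast (normConst_pos d).ne'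
  refine (mul_eq_zero.1 ?_).resolve_left hA
  rw [Finset.mul_sum, ← e1]
  refine Finset.sum_congr rfl fun k hk => ?_
  rw [e3 k hk, e2 k hk, phi_apply]
  ring

theorem exists_continuous_of_finitelyManyModes {w : L2 d} (hw : FinitelyManyModes w) :
    ∃ m : C(Torus d, ℝ), w =ᵐ[volume] m := by
  obtain ⟨S, hS⟩ := hw.exists_finset
  refine ⟨∑ k ∈ S, modeFun k (coef w k), ?_⟩
  have : w = ContinuousMap.toLp 2 volume ℝ (∑ k ∈ S, modeFun k (coef w k)) := by
    rw [map_sum]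
    refine (hasSum_mode_coef w).unique (hasSum_sum_of_ne_finset_zero fun k hk => ?_)
    have h0 : coef w k = 0 := by simpa [hS] using hk
    have := mode_real_mul k 0 (coef w k)
    rw [h0] at this ⊢
    simpa using this
  conv_lhs => rw [this]
  exact ContinuousMap.coeFn_toLp (p := 2) (𝕜 := ℝ) volume _

/-- If `g` is orthogonal to all these products, then `w g` has vanishing Fourier coefficients, hence
is zero; since `w ≠ 0` almost everywhere, `g = 0`. The continuous representative `m` of `w` keeps
the product in `L²`. -/
theorem span_mulL2_trig_closure_eq_top {w : L2 d} (hw : FinitelyManyModes w) (hne : w ≠ 0) :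
    (Submodule.span ℝ (range fun p : (Fin d → ℤ) × ℂ => mulL2 (trig p.1 p.2) w)).topologicalClosure
      = ⊤ := by
  rw [Submodule.topologicalClosure_eq_top_iff, Submodule.eq_bot_iff]
  intro g hg
  obtain ⟨m, hm⟩ := exists_continuous_of_finitelyManyModes hw
  have hinner : ∀ k c, inner ℝ (mode k c) (mulL2 m g) = 0 := by
    intro k c
    have h := Submodule.inner_right_of_mem_orthogonal
      (Submodule.subset_span (mem_range_self (k, c * (normConst d : ℂ)))) hg
    rw [← h, L2.inner_def, L2.inner_def]
    refine integral_congr_ae ?_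
    filter_upwards [coeFn_mode k c, coeFn_mulL2 m g, coeFn_mulL2 (trig k (c * normConst d)) w, hm]
      with x h1 h2 h3 h4
    rw [h1, h2, h3, h4, trig_apply, phi_apply, mul_assoc]
    simp only [RCLike.inner_apply, conj_trivial]
    ring
  have hzero : mulL2 m g = 0 := L2_ext fun k => by
    rw [coef_zero, coef_eq_inner, hinner, hinner]
    simp
  refine Lp.ext ?_
  have h0 : mulL2 m g =ᵐ[volume] 0 := by
    rw [hzero]
    exact Lp.coeFn_zero _ _ _
  filter_upwards [h0, coeFn_mulL2 m g, hm, ae_ne_zero_of_finitelyManyModes hw hne,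
    Lp.coeFn_zero ℝ 2 (volume : Measure (Torus d))] with x h1 h2 h3 h4 h5
  rw [h5]
  rw [h2] at h1
  rw [h3] at h4
  exact (mul_eq_zero.1 h1).resolve_left h4

theorem exists_kickable_norm_sub_lt {w : L2 d} (hw : FinitelyManyModes w) (hne : w ≠ 0) (g : L2 d)
    {ε : ℝ} (hε : 0 < ε) : ∃ f, Kickable f ∧ ‖mulL2 f w - g‖ < ε := by
  -- Kickability of all real multiples is carried through the induction, because kickability of `f`
  -- alone does not give that of `-f`.
  have hspan : ∀ h ∈ Submodule.span ℝ (range fun p : (Fin d → ℤ) × ℂ => mulL2 (trig p.1 p.2) w),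
      ∃ f, (∀ a : ℝ, Kickable (a • f)) ∧ mulL2 f w = h := by
    intro h hh
    induction hh using Submodule.span_induction with
    | mem x hx =>
      obtain ⟨p, rfl⟩ := hx
      exact ⟨trig p.1 p.2, fun a => by rw [smul_trig]; exact kickable_trig _ _, rfl⟩
    | zero =>
      refine ⟨0, fun a => by rw [smul_zero]; exact kickable_zero, ?_⟩
      rw [← zero_smul ℝ (0 : C(Torus d, ℝ)), smul_mulL2, zero_smul]
    | add x y _ _ hx hy =>
      obtain ⟨f, hf, rfl⟩ := hx
      obtain ⟨f', hf', rfl⟩ := hy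
      exact ⟨f + f', fun a => by rw [smul_add]; exact (hf a).add (hf' a), add_mulL2 _ _ _⟩
    | smul b x _ hx =>
      obtain ⟨f, hf, rfl⟩ := hx
      exact ⟨b • f, fun a => by rw [smul_smul]; exact hf _, smul_mulL2 _ _ _⟩
  have hg : g ∈ (Submodule.span ℝ
      (range fun p : (Fin d → ℤ) × ℂ => mulL2 (trig p.1 p.2) w)).topologicalClosure := by
    rw [span_mulL2_trig_closure_eq_top hw hne]
    trivial
  obtain ⟨h, hh, hd⟩ := Metric.mem_closure_iff.1 hg ε hε
  obtain ⟨f, hf, rfl⟩ := hspan h hh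
  refine ⟨f, by simpa using hf 1, ?_⟩
  rwa [dist_comm, dist_eq_norm] at hd

theorem toL2_ne_zero {w : H1 d} (hw : w ≠ 0) : w.toL2 ≠ 0 := fun h =>
  hw (H1_ext fun k => by rw [h, map_zero])

theorem reachIn_velocity {w : H1 d} (hw : FinitelyManyModes w.toL2) (hne : w ≠ 0) (v v' : L2 d)
    {T : ℝ} (hT : 0 < T) : ReachIn T (w, v) (w, v') := by
  refine reachIn_of_forall_exists fun ε hε => ?_
  obtain ⟨f, hf, hlt⟩ := exists_kickable_norm_sub_lt hw (toL2_ne_zero hne) (v' - v) hε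
  refine ⟨_, hf (w, v) T hT, ?_⟩
  have e : ((w, v) + kickCLM f (w, v) - (w, v') : State d) = (0, mulL2 f w.toL2 - (v' - v)) := by
    rw [kickCLM_apply]
    refine Prod.ext (by simp) ?_
    simp only [Prod.snd_sub, Prod.snd_add]
    abel
  rw [e, Prod.norm_mk, norm_zero, max_eq_right (norm_nonneg _)]
  exact hlt

/-! ### Control of the state -/

theorem FinitelyManyModes.of_coef {f g : L2 d} (hg : FinitelyManyModes g)
    (h : ∀ k, coef g k = 0 → coef f k = 0) : FinitelyManyModes f :=
  hg.subset fun k hk hk' => hk (h k hk')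

theorem FinitelyManyModes.add {f g : L2 d} (hf : FinitelyManyModes f) (hg : FinitelyManyModes g) :
    FinitelyManyModes (f + g) := by
  refine (hf.union hg).subset fun k hk => ?_
  by_contra h
  simp only [mem_union, mem_ofPred_eq, not_or, not_not] at h
  exact hk (by rw [coef_add, h.1, h.2, add_zero])

theorem FinitelyManyModes.smul {f : L2 d} (hf : FinitelyManyModes f) (a : ℝ) :
    FinitelyManyModes (a • f) :=
  hf.of_coef fun k hk => by rw [coef_smul, hk, mul_zero]

theorem finitelyManyModes_mode (k : Fin d → ℤ) (c : ℂ) : FinitelyManyModes (mode k c) := by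
  refine (Set.toFinite {k, -k}).subset fun j hj => ?_
  by_contra h
  simp only [mem_insert_iff, mem_singleton_iff, not_or] at h
  exact hj (coef_mode_eq_zero k j c h.1 h.2)

theorem dense_finitelyManyModes : Dense {u : H1 d | FinitelyManyModes u.toL2} := by
  intro u
  refine mem_closure_of_tendsto (H1.hasSum_mode_coef u) (Eventually.of_forall fun S => ?_)
  classical
  induction S using Finset.induction_on with
  | empty =>
    rw [Finset.sum_empty, mem_ofPred_eq, map_zero]
    simp [FinitelyManyModes, coef_zero]
  | insert k S hk ih =>
    rw [Finset.sum_insert hk, mem_ofPred_eq, map_add]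
    exact (finitelyManyModes_mode _ _).add ih

theorem nontrivial_H1 : Nontrivial (H1 d) := by
  refine ⟨⟨H1.mode 0 1, 0, fun h => ?_⟩⟩
  have h1 : modeFun (0 : Fin d → ℤ) 1 = 0 := by
    refine ContinuousMap.toLp_injective (p := 2) (𝕜 := ℝ) (volume : Measure (Torus d)) ?_
    rw [map_zero]
    exact congrArg H1.toL2 h
  have h2 := DFunLike.congr_fun h1 0
  rw [modeFun_eq_trig, trig_apply, expo_zero] at h2
  simp at h2
  exact (normConst_pos d).ne' h2

theorem reachIn_of_profile_ne_zero {w₀ : H1 d} (hw₀ : FinitelyManyModes w₀.toL2) (hne : w₀ ≠ 0)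
    (v₀ : L2 d) (w₁ : H1 d) (v₁ : L2 d) {T : ℝ} (hT : 0 < T) :
    ReachIn T (w₀, v₀) (w₁, v₁) := by
  refine reachIn_of_forall_exists fun ε hε => ?_
  have := nontrivial_H1 (d := d)
  have hdense : Dense ({u : H1 d | FinitelyManyModes u.toL2} ∩ {(0 : H1 d)}ᶜ) :=
    dense_finitelyManyModes.inter_of_isOpen_right (dense_compl_singleton 0) isOpen_compl_singleton
  -- The intermediate target must be nonzero even when `w₁ = 0`: the last velocity correction acts
  -- by multiplying the profile.
  obtain ⟨w, ⟨hw, hw0⟩, hd⟩ := Metric.mem_closure_iff.1 (hdense w₁) ε hε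
  set g := w - w₀ with hg
  have hlim : Tendsto (fun t : ℝ => cosH1 d t w₀ + t⁻¹ • sinOp d t g.toL2) (𝓝[>] 0) (𝓝 w) := by
    have h1 : Tendsto (fun t : ℝ => cosH1 d t w₀) (𝓝[>] 0) (𝓝 w₀) := by
      have h := ((continuous_cosH1 w₀).tendsto 0).mono_left
        (nhdsWithin_le_nhds (s := Ioi 0))
      have e : cosH1 d 0 w₀ = w₀ := H1_ext fun k => by simp [coef_cosH1]
      rwa [e] at h
    have h2 := (tendsto_inv_smul_sinOp_H1 g).mono_left
      (nhdsWithin_mono (0 : ℝ) (fun t (ht : t ∈ Ioi 0) => ne_of_gt ht))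
    have h3 := h1.add h2
    rwa [hg, add_sub_cancel] at h3
  have e1 : ∀ᶠ t : ℝ in 𝓝[>] 0, cosH1 d t w₀ + t⁻¹ • sinOp d t g.toL2 ≠ 0 :=
    hlim.eventually (isOpen_ne.mem_nhds hw0)
  have e2 : ∀ᶠ t : ℝ in 𝓝[>] 0, dist w₁ (cosH1 d t w₀ + t⁻¹ • sinOp d t g.toL2) < ε :=
    (tendsto_const_nhds.dist hlim).eventually (gt_mem_nhds hd)
  have e3 : ∀ᶠ t : ℝ in 𝓝[>] 0, t < T / 3 :=
    nhdsWithin_le_nhds (gt_mem_nhds (by positivity))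
  obtain ⟨t, ⟨⟨ht1, ht2⟩, ht3⟩, ht0⟩ := (((e1.and e2).and e3).and self_mem_nhdsWithin).exists
  -- Fourier multipliers create no new frequencies, so the profile remains a trigonometric
  -- polynomial.
  have hfin : FinitelyManyModes (cosH1 d t w₀ + t⁻¹ • sinOp d t g.toL2).toL2 := by
    rw [map_add, map_smul]
    refine (hw₀.of_coef fun k hk => ?_).add (FinitelyManyModes.smul ?_ _)
    · rw [coef_cosH1, hk, mul_zero]
    · have hgf : FinitelyManyModes g.toL2 := by
        rw [hg, sub_eq_add_neg, ← neg_one_smul ℝ w₀, map_add, map_smul]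
        exact FinitelyManyModes.add hw (hw₀.smul _)
      exact hgf.of_coef fun k hk => by rw [coef_sinOp, hk, mul_zero]
  refine ⟨(cosH1 d t w₀ + t⁻¹ • sinOp d t g.toL2, v₁), ?_, ?_⟩
  · have r1 := reachIn_velocity hw₀ hne v₀ (t⁻¹ • g.toL2) (show 0 < T / 3 by positivity)
    have r2 := r1.trans (reachIn_waveGroup (le_of_lt ht0) ht3 _)
    rw [waveGroup_apply] at r2
    simp only [map_smul] at r2
    have r3 := r2.trans (reachIn_velocity hfin ht1 _ v₁ (show 0 < T / 3 by positivity))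
    rwa [add_thirds] at r3
  · rw [Prod.mk_sub_mk, sub_self, Prod.norm_mk, norm_zero, max_eq_left (norm_nonneg _),
      ← dist_eq_norm, dist_comm]
    exact ht2

/-- The profile after time `t` divided by `t` tends to `v₀ ≠ 0` in `L²`, so it is nonzero for small
`t > 0`. -/
theorem exists_sinOp_ne_zero {v₀ : L2 d} (hv₀ : v₀ ≠ 0) {T : ℝ} (hT : 0 < T) :
    ∃ t, 0 < t ∧ t < T ∧ sinOp d t v₀ ≠ 0 := by
  have h := (tendsto_inv_smul_toL2_sinOp v₀).mono_left
    (nhdsWithin_mono (0 : ℝ) (fun t (ht : t ∈ Ioi 0) => ne_of_gt ht))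
  have e1 := h.eventually (isOpen_ne.mem_nhds hv₀)
  have e3 : ∀ᶠ t : ℝ in 𝓝[>] 0, t < T := nhdsWithin_le_nhds (gt_mem_nhds hT)
  obtain ⟨t, ⟨h1, h2⟩, h3⟩ := ((e1.and e3).and self_mem_nhdsWithin).exists
  refine ⟨t, h3, h2, fun h0 => h1 ?_⟩
  rw [h0, map_zero, smul_zero]

theorem reachIn_of_finitelyManyModes {w₀ : H1 d} {v₀ : L2 d}
    (h₀ : (w₀ ≠ 0 ∧ FinitelyManyModes w₀.toL2) ∨ (w₀ = 0 ∧ v₀ ≠ 0 ∧ FinitelyManyModes v₀))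
    (w₁ : H1 d) (v₁ : L2 d) {T : ℝ} (hT : 0 < T) : ReachIn T (w₀, v₀) (w₁, v₁) := by
  rcases h₀ with ⟨hne, hfin⟩ | ⟨rfl, hne, hfin⟩
  · exact reachIn_of_profile_ne_zero hfin hne v₀ w₁ v₁ hT
  · obtain ⟨t, ht0, htT, hs⟩ := exists_sinOp_ne_zero hne (half_pos hT)
    have r1 := reachIn_waveGroup ht0.le htT (0, v₀)
    rw [waveGroup_apply] at r1
    simp only [map_zero, zero_add] at r1
    have hfin' : FinitelyManyModes (sinOp d t v₀).toL2 :=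
      hfin.of_coef fun k hk => by rw [coef_sinOp, hk, mul_zero]
    have r2 := r1.trans (reachIn_of_profile_ne_zero hfin' hs (cosL2 d t v₀) w₁ v₁ (half_pos hT))
    rwa [add_halves] at r2

theorem energyNorm_le (W : State d) : energyNorm W ≤ 2 * ‖W‖ := by
  rw [energyNorm]
  refine Real.sqrt_le_iff.2 ⟨by positivity, ?_⟩
  have h1 := pow_le_pow_left₀ (norm_nonneg _) (norm_fst_le W) 2
  have h2 := pow_le_pow_left₀ (norm_nonneg _) (norm_snd_le W) 2
  nlinarith [sq_nonneg ‖W‖]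

end BilinearWave

end

open BilinearWave
theorem mainTheorem2 (d : ℕ) (w₀ : H1 d) (v₀ : L2 d)
    (h₀ : (w₀ ≠ 0 ∧ FinitelyManyModes w₀.toL2) ∨ (w₀ = 0 ∧ v₀ ≠ 0 ∧ FinitelyManyModes v₀))
    (w₁ : H1 d) (v₁ : L2 d) (ε T : ℝ) (hε : 0 < ε) (hT : 0 < T) :
    ∃ τ ∈ Set.Ico 0 T, ∃ p : ℝ → Fin (2 * d + 1) → ℝ, IsPiecewiseConstant τ p ∧
      (∃ W : ℝ → State d, IsSolution τ p (w₀, v₀) W) ∧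
      ∀ W : ℝ → State d, IsSolution τ p (w₀, v₀) W → energyNorm (W τ - (w₁, v₁)) < ε := by
  obtain ⟨τ, hτT, Φ, ⟨hτ, p, hpc, ⟨B, hB⟩, hp⟩, hlt⟩ :=
    -- The tolerance is halved to pay for the factor `2` between the energy norm and the maximum
    -- norm on the product.
    reachIn_of_finitelyManyModes h₀ w₁ v₁ hT (ε / 2) (by positivity)
  obtain ⟨V, hV, e⟩ := hp (w₀, v₀)
  refine ⟨τ, ⟨hτ, hτT⟩, p, hpc, ⟨V, hV⟩, fun W hW => ?_⟩
  obtain ⟨C, hC⟩ := exists_dist_le_of_isSolution hτ hB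
  have huniq : W τ = V τ := by
    have := hC _ _ _ _ hW hV
    rw [sub_self, norm_zero, mul_zero] at this
    exact sub_eq_zero.1 (norm_le_zero_iff.1 this)
  rw [huniq, e]
  exact (energyNorm_le _).trans_lt (by linarith)
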